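/- Let $I,J\subseteq[n]$, let $\overline J=\{\overline j\mid j\in J\}$, and order $[n]\sqcup[\overline n]$ by $1\prec\overline 1\prec 2\prec\overline 2\prec\cdots\prec n\prec\overline n$. Assume that $(I,\overline J)$ is valid, i.e. $\min(I\sqcup\overline J)\in I$ and $\max(I\sqcup\overline J)\in\overline J$. For $\overline j\in\overline J$ let $\mathrm{prec}(\overline j)\in[n]$ be the element of $I$ that immediately precedes $\overline j$ in the order induced on $I\sqcup\overline J$, if there is one, and $\mathrm{prec}(\overline j)=j$ otherwise. Let $G=G(I,\overline J)$ be the graph with vertex set $I\cup\mathrm{prec}(\overline J)$ obtained from the graph with edges $(i,\mathrm{prec}(\overline j))$, $i\in I$, $\overline j\in\overline J$, $i<\mathrm{prec}(\overline j)$, by deleting every edge $(a,b)$ for which that graph has a directed path from $a$ to $b$ with at least one intermediate vertex. Edges $(i,j),(j,k)$ with $i<j<k$ of a graph $H$ on $V(G)$ form a longest pair (at $j$) in $H$ if $H$ has no edge $(i',j)$ with $i'<i$ and no edge $(j,k')$ with $k'>k$. Reducing $H$ at this pair produces the three graphs with edge sets $$E(H)\setminus\{(j,k)\}\cup\{(i,k)\},\qquad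 E(H)\setminus\{(i,j)\}\cup\{(i,k)\},\qquad E(H)\setminus\{(i,j),(j,k)\}\cup\{(i,k)\}.$$ A graph is alternating if it has no edges $(i,j),(j,k)$ with $i<j<k$, and non-crossing if it has no edges $(i,j),(i',j')$ with $i<i'<j<j'$. Let $\mathcal D_{I,\overline J}$ be the set of all graphs that are maximal, with respect to inclusion of edge sets, among the alternating non-crossing graphs on the vertex set $I\cup\mathrm{prec}(\overline J)$ whose edges $(i,j)$ satisfy $i<j$, $i\in I$ and $j\in\mathrm{prec}(\overline J)$. In $\mathbb Z[\beta][x_{ij}\mid 1\le i<j\le n]$ let $M_G=\prod_{(a,b)\in E(G)}x_{ab}$. A longest-pair reduction step on a polynomial $p$ chooses $i<j<k$ and a non-empty set of monomials of $p$ such that $(i,j),(j,k)$ is a longest pair in the graph of each chosen monomial (whose edges are the $(a,b)$ for which $x_{ab}$ divides it), and substitutes the factor $x_{ij}x_{jk}$ of each of them by $x_{ik}x_{ij}+x_{jk}x_{ik}+\beta x_{ik}$. In particular, all monomials divisible by $x_{ij}x_{jk}$ may be reduced together, provided that the pair is longest in each of them. A longest-pair reduced form of $M_G$ is a polynomial,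 none of whose monomials is divisible by an $x_{ij}x_{jk}$ with $i<j<k$, that is obtained from $M_G$ by a finite sequence of such steps. Then the following hold. 1. Any two longest-pair reduced forms of $M_G$ are equal. 2. For every reduction tree with root $G$ (a finite rooted tree whose nodes are graphs, in which every node is either an alternating graph and a leaf, or has as children the three graphs obtained by reducing it at one of its longest pairs), the set of full-dimensional leaves, i.e. of leaves with $|E(G)|$ edges, is exactly $\mathcal D_{I,\overline J}$. 3. Every graph in $\mathcal D_{I,\overline J}$ is a tree on the vertex set $I\cup\mathrm{prec}(\overline J)$. -/

import Mathlib

namespace IJTamari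

open scoped Classical

/-! ### The graph `G(I, J̄)`

The index set `[n]` is `Fin n`; a subset `J̄` of `[n̄]` is given by the finset `J` of its underlying
indices. A graph is given by its finite set of edges `(i, j)`, directed from `i` to `j`; its vertex
set is understood. -/

/-- The unbarred copy of `i` in `[n] ⊔ [n̄]`. The lexicographic order on `Fin n ×ₗ Bool` is the order
`1 ≺ 1̄ ≺ 2 ≺ 2̄ ≺ ⋯ ≺ n ≺ n̄`. -/
def unbarred {n : ℕ} (i : Fin n) : Fin n ×ₗ Bool := toLex (i, false)

/-- The barred copy `j̄` of `j` in `[n] ⊔ [n̄]`. -/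
def barred {n : ℕ} (j : Fin n) : Fin n ×ₗ Bool := toLex (j, true)

/-- The set `I ⊔ J̄` inside `[n] ⊔ [n̄]`. -/
noncomputable def points {n : ℕ} (I J : Finset (Fin n)) : Finset (Fin n ×ₗ Bool) :=
  I.image unbarred ∪ J.image barred

/-- `(I, J̄)` is valid: the minimum of `I ⊔ J̄` lies in `I` and the maximum lies in `J̄`. -/
def IsValidPair {n : ℕ} (I J : Finset (Fin n)) : Prop :=
  (∃ i ∈ I, ∀ x ∈ points I J, unbarred i ≤ x) ∧ (∃ j ∈ J, ∀ x ∈ points I J, x ≤ barred j)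

/-- `x` immediately precedes `y` in the order induced on `I ⊔ J̄`. -/
def ImmediatelyPrecedes {n : ℕ} (I J : Finset (Fin n)) (x y : Fin n ×ₗ Bool) : Prop :=
  x ∈ points I J ∧ y ∈ points I J ∧ x < y ∧ ∀ z ∈ points I J, ¬ (x < z ∧ z < y)

/-- The map `prec : J̄ → [n]` (used only at `j ∈ J`): the element of `I` that immediately precedes
`j̄`, if there is one, and `j` otherwise. -/
noncomputable def prec {n : ℕ} (I J : Finset (Fin n)) (j : Fin n) : Fin n :=
  if h : ∃ i, i ∈ I ∧ ImmediatelyPrecedes I J (unbarred i) (barred j) then h.choose else j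

/-- The edges of `A(I, J̄)`; the pair `(i, j)` stands for the arc `(i, j̄)` with `i ≺ j̄`. -/
noncomputable def arcs {n : ℕ} (I J : Finset (Fin n)) : Finset (Fin n × Fin n) :=
  (I ×ˢ J).filter fun a => unbarred a.1 < barred a.2

/-- The edges of the quotient graph `prec(A(I, J̄))`, without loops. -/
noncomputable def precArcs {n : ℕ} (I J : Finset (Fin n)) : Finset (Fin n × Fin n) :=
  ((arcs I J).image fun a => (a.1, prec I J a.2)).filter fun e => e.1 < e.2

/-- The minimal graph of `H`: delete each edge `(i, j)` for which `H` has a directed path from `i` to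
`j` with at least one intermediate vertex. -/
noncomputable def minimalGraph {n : ℕ} (H : Finset (Fin n × Fin n)) : Finset (Fin n × Fin n) :=
  H.filter fun e => ¬ ∃ v, (e.1, v) ∈ H ∧ Relation.TransGen (fun a b => (a, b) ∈ H) v e.2

/-- The edges of `G(I, J̄)`. -/
noncomputable def graphIJ {n : ℕ} (I J : Finset (Fin n)) : Finset (Fin n × Fin n) :=
  minimalGraph (precArcs I J)

/-- The vertex set `I ∪ prec(J̄)` of `G(I, J̄)`. -/
noncomputable def vertexSet {n : ℕ} (I J : Finset (Fin n)) : Finset (Fin n) :=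
  I ∪ J.image (prec I J)

/-! ### Alternating and non-crossing graphs -/

/-- No two edges `(i, j)`, `(j, k)` with `i < j < k`. -/
def IsAlternating {n : ℕ} (H : Finset (Fin n × Fin n)) : Prop :=
  ∀ i j k, i < j → j < k → (i, j) ∈ H → (j, k) ∉ H

/-- No two edges `(i, j)`, `(i', j')` with `i < i' < j < j'`. -/
def IsNonCrossing {n : ℕ} (H : Finset (Fin n × Fin n)) : Prop :=
  ∀ i j i' j', (i, j) ∈ H → (i', j') ∈ H → ¬ (i < i' ∧ i' < j ∧ j < j')

/-- The alternating non-crossing graphs on the vertex set `I ∪ prec(J̄)` whose edges `(i, j)`, `i < j`,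
satisfy `i ∈ I` and `j ∈ prec(J̄)`. -/
def IsAltNonCrossing {n : ℕ} (I J : Finset (Fin n)) (H : Finset (Fin n × Fin n)) : Prop :=
  (∀ e ∈ H, e.1 < e.2 ∧ e.1 ∈ I ∧ e.2 ∈ J.image (prec I J)) ∧ IsAlternating H ∧ IsNonCrossing H

/-- The set `𝒟(I, J̄)` of all graphs as above that are maximal with respect to inclusion of edges. -/
def maximalAltNonCrossing {n : ℕ} (I J : Finset (Fin n)) : Set (Finset (Fin n × Fin n)) :=
  {H | Maximal (IsAltNonCrossing I J) H}

/-- The graph with vertex set `V` and edge set `H` is, when orientations are forgotten, a tree. -/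
def IsTreeOn {n : ℕ} (V : Finset (Fin n)) (H : Finset (Fin n × Fin n)) : Prop :=
  (∀ e ∈ H, e.1 ∈ V ∧ e.2 ∈ V) ∧
    (SimpleGraph.fromRel fun a b : {v // v ∈ V} => (a.1, b.1) ∈ H).IsTree

/-! ### Reductions of graphs -/

/-- The non-alternating edges `(i, j)`, `(j, k)` form a longest pair at `j` in `H`. -/
def IsLongestPair {n : ℕ} (H : Finset (Fin n × Fin n)) (i j k : Fin n) : Prop :=
  i < j ∧ j < k ∧ (i, j) ∈ H ∧ (j, k) ∈ H ∧
    (∀ i' < i, (i', j) ∉ H) ∧ (∀ k', k < k' → (j, k') ∉ H)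

/-- `E(G₁) = E(G) \ {(j, k)} ∪ {(i, k)}`. -/
def reduction₁ {n : ℕ} (H : Finset (Fin n × Fin n)) (i j k : Fin n) : Finset (Fin n × Fin n) :=
  (H \ {(j, k)}) ∪ {(i, k)}

/-- `E(G₂) = E(G) \ {(i, j)} ∪ {(i, k)}`. -/
def reduction₂ {n : ℕ} (H : Finset (Fin n × Fin n)) (i j k : Fin n) : Finset (Fin n × Fin n) :=
  (H \ {(i, j)}) ∪ {(i, k)}

/-- `E(G₃) = E(G) \ {(i, j), (j, k)} ∪ {(i, k)}`. -/
def reduction₃ {n : ℕ} (H : Finset (Fin n × Fin n)) (i j k : Fin n) : Finset (Fin n × Fin n) :=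
  (H \ {(i, j), (j, k)}) ∪ {(i, k)}

/-- The reduction trees with root `H` in which every reduction is performed on a longest pair of the
graph that is reduced, and whose leaves are not reducible. Each node may be reduced at any of its
longest pairs, whatever is chosen at other nodes; the trees in which all leaves that contain a pair
are reduced together at that pair are among these. -/
inductive LongestReductionTree {n : ℕ} : Finset (Fin n × Fin n) → Type
  | leaf (H : Finset (Fin n × Fin n)) (h : IsAlternating H) : LongestReductionTree H
  | node (H : Finset (Fin n × Fin n)) (i j k : Fin n) (h : IsLongestPair H i j k)
      (t₁ : LongestReductionTree (reduction₁ H i j k))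
      (t₂ : LongestReductionTree (reduction₂ H i j k))
      (t₃ : LongestReductionTree (reduction₃ H i j k)) : LongestReductionTree H

/-- The graphs at the leaves of a reduction tree. -/
def LongestReductionTree.leaves {n : ℕ} {H : Finset (Fin n × Fin n)} :
    LongestReductionTree H → Set (Finset (Fin n × Fin n))
  | .leaf H _ => {H}
  | .node _ _ _ _ _ t₁ t₂ t₃ => t₁.leaves ∪ t₂.leaves ∪ t₃.leaves

/-- The leaves with as many edges as the root. -/
def LongestReductionTree.fullDimensionalLeaves {n : ℕ} {H : Finset (Fin n × Fin n)}
    (R : LongestReductionTree H) : Set (Finset (Fin n × Fin n)) :=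
  {L | L ∈ R.leaves ∧ L.card = H.card}

/-! ### Reductions of polynomials

Polynomials in the commuting variables `x_{ij}` with coefficients in `ℤ[β]`, before the relations of
the subdivision algebra are imposed. Only the variables `x_{ij}` with `i < j` ever occur. -/

/-- The ring `ℤ[β][x_{ij}]`. -/
abbrev Poly (n : ℕ) : Type := MvPolynomial (Fin n × Fin n) (Polynomial ℤ)

/-- The monomial `M_G`, the product of the `x_{ab}` over the edges `(a, b)` of `G`. -/
noncomputable def graphMonomial {n : ℕ} (G : Finset (Fin n × Fin n)) : Poly n :=
  ∏ e ∈ G, MvPolynomial.X e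

/-- `x_{ik} x_{ij} + x_{jk} x_{ik} + β x_{ik}`, which replaces `x_{ij} x_{jk}`. -/
noncomputable def replacement {n : ℕ} (i j k : Fin n) : Poly n :=
  MvPolynomial.X (i, k) * MvPolynomial.X (i, j) + MvPolynomial.X (j, k) * MvPolynomial.X (i, k) +
    MvPolynomial.C Polynomial.X * MvPolynomial.X (i, k)

/-- For a monomial `m` divisible by `x_{ij} x_{jk}`: substitute this factor of `c * m`, `c ∈ ℤ[β]`. -/
noncomputable def reduceMonomial {n : ℕ} (i j k : Fin n) (m : (Fin n × Fin n) →₀ ℕ)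
    (c : Polynomial ℤ) : Poly n :=
  MvPolynomial.monomial (m - (Finsupp.single (i, j) 1 + Finsupp.single (j, k) 1)) c *
    replacement i j k

/-- Substitute the factor `x_{ij} x_{jk}` in the monomials of `p` that belong to `S`, and leave the
other monomials of `p` as they are. -/
noncomputable def reduceOn {n : ℕ} (i j k : Fin n) (S : Finset ((Fin n × Fin n) →₀ ℕ))
    (p : Poly n) : Poly n :=
  ∑ m ∈ p.support,
    if m ∈ S then reduceMonomial i j k m (p.coeff m) else MvPolynomial.monomial m (p.coeff m)

/-- One step of a reduction order that reduces longest pairs: some monomials of `p` (at least one) in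
which `(i, j)`, `(j, k)` form a longest pair are reduced at this pair. The step may reduce any such
set `S` of monomials: that of all monomials of `p` divisible by `x_{ij} x_{jk}`, provided the pair is
longest in each of them, a single monomial, or anything in between. -/
def LongestReductionStep {n : ℕ} (p p' : Poly n) : Prop :=
  ∃ (i j k : Fin n) (S : Finset ((Fin n × Fin n) →₀ ℕ)), S.Nonempty ∧ S ⊆ p.support ∧
    (∀ m ∈ S, IsLongestPair m.support i j k) ∧ p' = reduceOn i j k S p

/-- No reduction is possible in `p`: no monomial of `p` is divisible by a product `x_{ij} x_{jk}` with
`i < j < k`. -/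
def IsReduced {n : ℕ} (p : Poly n) : Prop :=
  ∀ m ∈ p.support, IsAlternating m.support

/-- `q` is a reduced form of `p` obtained by reducing a longest pair at every step. -/
def IsLongestReducedForm {n : ℕ} (p q : Poly n) : Prop :=
  Relation.ReflTransGen LongestReductionStep p q ∧ IsReduced q

end IJTamari

/-!
Write `P` for `prec(J̄)` and `V = I ∪ P`. Validity puts the minimum of `V` into `I` and its maximum into
`P`. Apart from this, the one property of `prec` that matters is that each interval from an element of `I`
to an element of `P` meets `I ∩ P` (`exists_mem_inter_between`). It implies that `G(I, J̄)`, whose edges are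
the pairs `a < b`, `a ∈ I`, `b ∈ P`, without an element of `I ∩ P` strictly between, is a non-crossing
spanning tree of `V`. Both properties persist: the first and the second reduction of a spanning tree at a
pair are spanning trees, and reducing a non-crossing graph at a longest pair creates no crossing, since an
edge that crosses the new edge `(i, k)` crosses `(i, j)` or `(j, k)`, or shares the vertex `j` with one of
them and is longer. The third reduction loses an edge. So the full-dimensional leaves of a reduction tree
are alternating non-crossing spanning trees (`LongestReductionTree.leaves_spec`).

That every maximal alternating non-crossing graph `D` is a leaf is shown by flows. Put one unit of flow on
each edge of `D`. Since `G(I, J̄)` has a path for each edge of `D`, there is a flow on `G(I, J̄)` with the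
same net flow at each vertex. In a reduction it can be pushed to the first or the second reduced graph, by
rerouting units from the path `i → j → k` to the edge `(i, k)` until `(i, j)` or `(j, k)` carries nothing.
This ends in a full-dimensional leaf `L`. An alternating non-crossing flow is determined by its net flow,
as a system of parentheses is matched in one way only (`eq_of_netFlow_eq`), so `D ⊆ L`, and `D = L` by
maximality. Conversely a full-dimensional leaf is contained in a maximal graph, which is a leaf as well and
has the same number of edges.

Reduced forms are unique because the reductions of longest pairs are confluent on non-crossing graphs
contained in a spanning tree. A vertex carries at most one longest pair. Longest pairs at different vertices
do not interfere, because the graph is non-crossing, unless they form a path `a → b → c → d`; there both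
orders of reduction lead to the same graphs (`reducedSum_eq_of_adjacent`). So each graph has a normal form
that does not depend on the choice of the pairs, and its linear extension to polynomials is invariant under
the reduction steps. No square of a variable ever occurs, since a subgraph of a tree contains no
triangle.
-/

namespace IJTamari

open scoped Classical

/-! ### The vertices of `G(I, J̄)` and its edges -/

theorem unbarred_lt_barred {n : ℕ} {i j : Fin n} : unbarred i < barred j ↔ i ≤ j := by
  simp only [unbarred, barred, Prod.Lex.toLex_lt_toLex, le_iff_lt_or_eq]
  simp

theorem unbarred_le_barred {n : ℕ} {i j : Fin n} : unbarred i ≤ barred j ↔ i ≤ j := by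
  simp only [unbarred, barred, Prod.Lex.toLex_le_toLex, le_iff_lt_or_eq (a := i)]
  simp

theorem unbarred_lt_unbarred {n : ℕ} {i j : Fin n} : unbarred i < unbarred j ↔ i < j := by
  simp [unbarred, Prod.Lex.toLex_lt_toLex]

theorem unbarred_le_unbarred {n : ℕ} {i j : Fin n} : unbarred i ≤ unbarred j ↔ i ≤ j :=
  le_iff_le_iff_lt_iff_lt.2 unbarred_lt_unbarred

theorem barred_lt_barred {n : ℕ} {i j : Fin n} : barred i < barred j ↔ i < j := by
  simp [barred, Prod.Lex.toLex_lt_toLex]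

theorem barred_le_barred {n : ℕ} {i j : Fin n} : barred i ≤ barred j ↔ i ≤ j :=
  le_iff_le_iff_lt_iff_lt.2 barred_lt_barred

theorem unbarred_mem_points {n : ℕ} {I J : Finset (Fin n)} {i : Fin n} (hi : i ∈ I) :
    unbarred i ∈ points I J :=
  Finset.mem_union_left _ (Finset.mem_image_of_mem _ hi)

theorem barred_mem_points {n : ℕ} {I J : Finset (Fin n)} {j : Fin n} (hj : j ∈ J) :
    barred j ∈ points I J :=
  Finset.mem_union_right _ (Finset.mem_image_of_mem _ hj)

theorem prec_eq_self_or {n : ℕ} (I J : Finset (Fin n)) (j : Fin n) :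
    prec I J j = j ∨
      (prec I J j ∈ I ∧ ImmediatelyPrecedes I J (unbarred (prec I J j)) (barred j)) := by
  unfold prec
  split_ifs with h
  · exact Or.inr h.choose_spec
  · exact Or.inl rfl

theorem prec_eq_of_immediatelyPrecedes {n : ℕ} {I J : Finset (Fin n)} {i j : Fin n} (hi : i ∈ I)
    (h : ImmediatelyPrecedes I J (unbarred i) (barred j)) : prec I J j = i := by
  have hex : ∃ i, i ∈ I ∧ ImmediatelyPrecedes I J (unbarred i) (barred j) := ⟨i, hi, h⟩
  have h' := hex.choose_spec.2
  have hp : prec I J j = hex.choose := by unfold prec; rw [dif_pos hex]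
  rw [hp]
  rcases lt_trichotomy hex.choose i with hlt | heq | hlt
  · exact absurd ⟨unbarred_lt_unbarred.2 hlt, h.2.2.1⟩ (h'.2.2.2 _ h.1)
  · exact heq
  · exact absurd ⟨unbarred_lt_unbarred.2 hlt, h'.2.2.1⟩ (h.2.2.2 _ h'.1)

theorem prec_le {n : ℕ} (I J : Finset (Fin n)) (j : Fin n) : prec I J j ≤ j := by
  rcases prec_eq_self_or I J j with h | h
  · exact h.le
  · exact unbarred_lt_barred.1 h.2.2.2.1

/-- An interval of `[n]` from an element of `I` to an element of `prec(J̄)` meets `I ∩ prec(J̄)`: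
the last element of `I` before the right end immediately precedes some `j̄`. -/
theorem exists_mem_inter_between {n : ℕ} {I J : Finset (Fin n)} {i p : Fin n} (hi : i ∈ I)
    (hp : p ∈ J.image (prec I J)) (hip : i ≤ p) :
    ∃ b ∈ I, b ∈ J.image (prec I J) ∧ i ≤ b ∧ b ≤ p := by
  by_cases hpI : p ∈ I
  · exact ⟨p, hpI, hp, hip, le_rfl⟩
  obtain ⟨j, hj, rfl⟩ := Finset.mem_image.1 hp
  have hpj : prec I J j = j := by
    rcases prec_eq_self_or I J j with h | h
    · exact h
    · exact absurd h.1 hpI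
  rw [hpj] at hip ⊢
  obtain ⟨a, ha, hamax⟩ := (I.filter (· ≤ j)).exists_max_image id ⟨i, by simp [hi, hip]⟩
  obtain ⟨b, hb, hbmin⟩ := (J.filter (a ≤ ·)).exists_min_image id
    ⟨j, by simpa [hj] using (Finset.mem_filter.1 ha).2⟩
  simp only [Finset.mem_filter, id] at ha hamax hb hbmin
  have hbj : b ≤ j := hbmin j ⟨hj, ha.2⟩
  refine ⟨a, ha.1, Finset.mem_image.2 ⟨b, hb.1, ?_⟩, hamax i ⟨hi, hip⟩, ha.2⟩
  refine prec_eq_of_immediatelyPrecedes ha.1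
    ⟨unbarred_mem_points ha.1, barred_mem_points hb.1, unbarred_lt_barred.2 hb.2, ?_⟩
  rintro z hz ⟨h₁, h₂⟩
  rcases Finset.mem_union.1 hz with hz | hz
  · obtain ⟨x, hx, rfl⟩ := Finset.mem_image.1 hz
    exact absurd (hamax x ⟨hx, (unbarred_lt_barred.1 h₂).trans hbj⟩)
      (not_le.2 (unbarred_lt_unbarred.1 h₁))
  · obtain ⟨y, hy, rfl⟩ := Finset.mem_image.1 hz
    exact absurd (hbmin y ⟨hy, unbarred_lt_barred.1 h₁⟩) (not_le.2 (barred_lt_barred.1 h₂))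

theorem IsValidPair.exists_min {n : ℕ} {I J : Finset (Fin n)} (h : IsValidPair I J) :
    ∃ i ∈ I, ∀ v ∈ vertexSet I J, i ≤ v := by
  obtain ⟨i, hi, hmin⟩ := h.1
  refine ⟨i, hi, fun v hv => ?_⟩
  have hI : ∀ v ∈ I, i ≤ v := fun v hv => unbarred_le_unbarred.1 (hmin _ (unbarred_mem_points hv))
  rcases Finset.mem_union.1 hv with hv | hv
  · exact hI v hv
  · obtain ⟨j, hj, rfl⟩ := Finset.mem_image.1 hv
    rcases prec_eq_self_or I J j with h | h
    · rw [h]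
      exact unbarred_le_barred.1 (hmin _ (barred_mem_points hj))
    · exact hI _ h.1

theorem IsValidPair.exists_max {n : ℕ} {I J : Finset (Fin n)} (h : IsValidPair I J) :
    ∃ p ∈ J.image (prec I J), ∀ v ∈ vertexSet I J, v ≤ p := by
  obtain ⟨k, hk, hmax⟩ := h.2
  refine ⟨prec I J k, Finset.mem_image_of_mem _ hk, fun v hv => ?_⟩
  rcases prec_eq_self_or I J k with hp | ⟨-, hp⟩
  · rw [hp]
    rcases Finset.mem_union.1 hv with hv | hv
    · exact unbarred_le_barred.1 (hmax _ (unbarred_mem_points hv))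
    · obtain ⟨j, hj, rfl⟩ := Finset.mem_image.1 hv
      exact (prec_le I J j).trans (barred_le_barred.1 (hmax _ (barred_mem_points hj)))
  · rcases Finset.mem_union.1 hv with hv | hv
    · by_contra hlt
      exact hp.2.2.2 _ (unbarred_mem_points hv) ⟨unbarred_lt_unbarred.2 (not_le.1 hlt),
        unbarred_lt_barred.2 (unbarred_le_barred.1 (hmax _ (unbarred_mem_points hv)))⟩
    · obtain ⟨j, hj, rfl⟩ := Finset.mem_image.1 hv
      rcases (barred_le_barred.1 (hmax _ (barred_mem_points hj))).eq_or_lt with rfl | hjk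
      · exact le_rfl
      · by_contra hlt
        exact hp.2.2.2 _ (barred_mem_points hj)
          ⟨unbarred_lt_barred.2 ((not_le.1 hlt).le.trans (prec_le I J j)),
            barred_lt_barred.2 hjk⟩

theorem mem_precArcs {n : ℕ} {I J : Finset (Fin n)} {a b : Fin n} :
    (a, b) ∈ precArcs I J ↔ a ∈ I ∧ b ∈ J.image (prec I J) ∧ a < b := by
  simp only [precArcs, arcs, Finset.mem_filter, Finset.mem_image, Finset.mem_product, Prod.exists,
    Prod.mk.injEq]
  constructor
  · rintro ⟨⟨i, j, ⟨⟨hi, hj⟩, -⟩, rfl, rfl⟩, hlt⟩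
    exact ⟨hi, ⟨j, hj, rfl⟩, hlt⟩
  · rintro ⟨ha, ⟨j, hj, rfl⟩, hlt⟩
    exact ⟨⟨a, j, ⟨⟨ha, hj⟩, unbarred_lt_barred.2 (hlt.le.trans (prec_le I J j))⟩, rfl, rfl⟩, hlt⟩

theorem mem_graphIJ {n : ℕ} {I J : Finset (Fin n)} {a b : Fin n} :
    (a, b) ∈ graphIJ I J ↔ a ∈ I ∧ b ∈ J.image (prec I J) ∧ a < b ∧
      ∀ c ∈ I, c ∈ J.image (prec I J) → ¬ (a < c ∧ c < b) := by
  have hlt : ∀ {v b : Fin n}, Relation.TransGen (fun a b => (a, b) ∈ precArcs I J) v b → v < b := by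
    intro v b h
    induction h with
    | single h => exact (mem_precArcs.1 h).2.2
    | tail _ h ih => exact ih.trans (mem_precArcs.1 h).2.2
  simp only [graphIJ, minimalGraph, Finset.mem_filter]
  constructor
  · rintro ⟨hab, hno⟩
    obtain ⟨ha, hb, hab⟩ := mem_precArcs.1 hab
    exact ⟨ha, hb, hab, fun c hc hc' h => hno ⟨c, mem_precArcs.2 ⟨ha, hc', h.1⟩,
      .single (mem_precArcs.2 ⟨hc, hb, h.2⟩)⟩⟩
  · rintro ⟨ha, hb, hab, hno⟩
    refine ⟨mem_precArcs.2 ⟨ha, hb, hab⟩, ?_⟩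
    rintro ⟨v, hav, hvb⟩
    obtain ⟨-, hv, hav⟩ := mem_precArcs.1 hav
    have hvI : v ∈ I := by
      obtain ⟨w, hw, -⟩ := Relation.TransGen.head'_iff.1 hvb
      exact (mem_precArcs.1 hw).1
    exact hno v hvI hv ⟨hav, hlt hvb⟩

theorem graphIJ_isNonCrossing {n : ℕ} (I J : Finset (Fin n)) : IsNonCrossing (graphIJ I J) := by
  rintro i j i' j' h h' ⟨h₁, h₂, h₃⟩
  rw [mem_graphIJ] at h h'
  -- `i' ∈ I` and `j ∈ prec(J̄)`, so `[i', j]` meets `I ∩ prec(J̄)`; this point lies inside `(i, j)`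
  -- or is `j`, and then lies inside `(i', j')`.
  obtain ⟨b, hb, hb', h₄, h₅⟩ := exists_mem_inter_between h'.1 h.2.1 h₂.le
  rcases h₅.eq_or_lt with rfl | h₅
  · exact h'.2.2.2 _ hb hb' ⟨h₂, h₃⟩
  · exact h.2.2.2 b hb hb' ⟨h₁.trans_le h₄, h₅⟩

/-- Induction along the paths of `G(I, J̄)`: every arc from `I` to `prec(J̄)` is the composite of a
directed path of `G(I, J̄)`. -/
theorem arc_induction {n : ℕ} {I J : Finset (Fin n)} {Q : Fin n → Fin n → Prop}
    (edge : ∀ a b, (a, b) ∈ graphIJ I J → Q a b)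
    (comp : ∀ a b c, a < b → b < c → Q a b → Q b c → Q a c) {a b : Fin n} (ha : a ∈ I)
    (hb : b ∈ J.image (prec I J)) (hab : a < b) : Q a b := by
  by_cases h : ∃ c ∈ I, c ∈ J.image (prec I J) ∧ a < c ∧ c < b
  · obtain ⟨c, hc, hc', hac, hcb⟩ := h
    exact comp a c b hac hcb (arc_induction edge comp ha hc' hac) (arc_induction edge comp hc hb hcb)
  · push Not at h
    exact edge a b (mem_graphIJ.2 ⟨ha, hb, hab, fun c hc hc' hlt =>
      absurd hlt.2 (not_lt.2 (h c hc hc' hlt.1))⟩)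
termination_by b.val - a.val
decreasing_by all_goals (simp only [Fin.lt_def] at *; omega)

/-! ### Spanning trees -/

/-- `H` is a spanning tree of the vertex set `V`. Connectedness is expressed by colourings: a
colouring of the vertices that is constant along each edge is constant. Absence of cycles is expressed
by the number of edges. -/
structure IsSpanningTree {n : ℕ} (V : Finset (Fin n)) (H : Finset (Fin n × Fin n)) : Prop where
  lt : ∀ e ∈ H, e.1 < e.2
  mem : ∀ e ∈ H, e.1 ∈ V ∧ e.2 ∈ V
  nonempty : V.Nonempty
  const : ∀ c : Fin n → Prop, (∀ e ∈ H, c e.1 = c e.2) → ∀ u ∈ V, ∀ v ∈ V, c u = c v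
  card_le : H.card + 1 ≤ V.card

theorem connected_of_const {n : ℕ} {V : Finset (Fin n)} {H : Finset (Fin n × Fin n)}
    (hlt : ∀ e ∈ H, e.1 < e.2) (hmem : ∀ e ∈ H, e.1 ∈ V ∧ e.2 ∈ V) (hne : V.Nonempty)
    (hconst : ∀ c : Fin n → Prop, (∀ e ∈ H, c e.1 = c e.2) → ∀ u ∈ V, ∀ v ∈ V, c u = c v) :
    (SimpleGraph.fromRel fun a b : {v // v ∈ V} => (a.1, b.1) ∈ H).Connected := by
  set Γ := SimpleGraph.fromRel fun a b : {v // v ∈ V} => (a.1, b.1) ∈ H with hΓ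
  have : Nonempty {v // v ∈ V} := hne.to_subtype
  refine ⟨fun u v => ?_⟩
  have h := hconst (fun w => ∃ hw : w ∈ V, Γ.Reachable u ⟨w, hw⟩) ?_ u.1 u.2 v.1 v.2
  · have h' := h.mp ⟨u.2, SimpleGraph.Reachable.refl u⟩
    exact h'.2
  · intro e he
    have hadj : Γ.Adj ⟨e.1, (hmem e he).1⟩ ⟨e.2, (hmem e he).2⟩ := by
      rw [hΓ, SimpleGraph.fromRel_adj]
      exact ⟨fun h => (hlt e he).ne (congrArg Subtype.val h), Or.inl he⟩
    refine propext ⟨fun ⟨_, h⟩ => ⟨(hmem e he).2, h.trans hadj.reachable⟩,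
      fun ⟨_, h⟩ => ⟨(hmem e he).1, h.trans hadj.symm.reachable⟩⟩

theorem card_edgeSet_fromRel_le {n : ℕ} (V : Finset (Fin n)) (H : Finset (Fin n × Fin n)) :
    Nat.card (SimpleGraph.fromRel fun a b : {v // v ∈ V} => (a.1, b.1) ∈ H).edgeSet ≤ H.card := by
  set Γ := SimpleGraph.fromRel fun a b : {v // v ∈ V} => (a.1, b.1) ∈ H with hΓ
  have hinj : Function.Injective (Sym2.map (Subtype.val : {v // v ∈ V} → Fin n)) :=
    Sym2.map.injective Subtype.val_injective
  rw [Nat.card_coe_set_eq, ← Set.ncard_image_of_injective _ hinj]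
  have hsub : Sym2.map Subtype.val '' Γ.edgeSet ⊆
      ((H.image fun e => s(e.1, e.2) : Finset (Sym2 (Fin n))) : Set (Sym2 (Fin n))) := by
    rintro _ ⟨x, hx, rfl⟩
    induction x using Sym2.ind with
    | _ a b =>
      rw [SimpleGraph.mem_edgeSet, hΓ, SimpleGraph.fromRel_adj] at hx
      simp only [Finset.coe_image, Sym2.map_mk, Set.mem_image, Finset.mem_coe]
      rcases hx.2 with h | h
      · exact ⟨_, h, rfl⟩
      · exact ⟨_, h, Sym2.eq_swap⟩
  refine (Set.ncard_le_ncard hsub (Finset.finite_toSet _)).trans ?_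
  rw [Set.ncard_coe_finset]
  exact Finset.card_image_le

theorem card_le_card_add_one_of_const {n : ℕ} {V : Finset (Fin n)} {H : Finset (Fin n × Fin n)}
    (hlt : ∀ e ∈ H, e.1 < e.2) (hmem : ∀ e ∈ H, e.1 ∈ V ∧ e.2 ∈ V) (hne : V.Nonempty)
    (hconst : ∀ c : Fin n → Prop, (∀ e ∈ H, c e.1 = c e.2) → ∀ u ∈ V, ∀ v ∈ V, c u = c v) :
    V.card ≤ H.card + 1 := by
  have h := (connected_of_const hlt hmem hne hconst).card_vert_le_card_edgeSet_add_one
  rw [Nat.card_eq_fintype_card, Fintype.card_coe] at h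
  exact h.trans (Nat.add_le_add_right (card_edgeSet_fromRel_le V H) 1)

theorem IsSpanningTree.isTreeOn {n : ℕ} {V : Finset (Fin n)} {H : Finset (Fin n × Fin n)}
    (h : IsSpanningTree V H) : IsTreeOn V H := by
  refine ⟨h.mem, ?_⟩
  have hc := connected_of_const h.lt h.mem h.nonempty h.const
  rw [SimpleGraph.isTree_iff_connected_and_card]
  refine ⟨hc, le_antisymm ?_ hc.card_vert_le_card_edgeSet_add_one⟩
  rw [Nat.card_eq_fintype_card (α := {v // v ∈ V}), Fintype.card_coe]
  exact (Nat.add_le_add_right (card_edgeSet_fromRel_le V H) 1).trans h.card_le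

/-- A spanning tree contains no triangle: deleting an edge of a triangle would leave a connected graph
with too few edges. -/
theorem IsSpanningTree.not_mem {n : ℕ} {V : Finset (Fin n)} {H : Finset (Fin n × Fin n)}
    (h : IsSpanningTree V H) {i j k : Fin n} (hij : (i, j) ∈ H) (hjk : (j, k) ∈ H) :
    (i, k) ∉ H := by
  intro hik
  have hne₁ : (i, k) ≠ (i, j) := fun he => (h.lt _ hjk).ne' (Prod.ext_iff.1 he).2
  have hne₂ : (i, k) ≠ (j, k) := fun he => (h.lt _ hij).ne (Prod.ext_iff.1 he).1
  have := card_le_card_add_one_of_const (H := H.erase (i, k))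
    (fun e he => h.lt e (Finset.mem_of_mem_erase he))
    (fun e he => h.mem e (Finset.mem_of_mem_erase he)) h.nonempty fun c hc => h.const c fun e he => by
      by_cases hek : e = (i, k)
      · subst hek
        exact (hc _ (Finset.mem_erase.2 ⟨hne₁.symm, hij⟩)).trans
          (hc _ (Finset.mem_erase.2 ⟨hne₂.symm, hjk⟩))
      · exact hc e (Finset.mem_erase.2 ⟨hek, he⟩)
  have := Finset.card_erase_lt_of_mem hik
  have := h.card_le
  omega

theorem graphIJ_card_lt {n : ℕ} {I J : Finset (Fin n)} (h : IsValidPair I J) :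
    (graphIJ I J).card + 1 ≤ (vertexSet I J).card := by
  set P := J.image (prec I J) with hP
  obtain ⟨i, hi, hmin⟩ := h.exists_min
  obtain ⟨p, hp, hmax⟩ := h.exists_max
  obtain ⟨b, hb, hb', -⟩ := exists_mem_inter_between hi hp (hmin p (Finset.mem_union_right _ hp))
  obtain ⟨r, hr, hrmin⟩ := (I ∩ P).exists_min_image id ⟨b, Finset.mem_inter.2 ⟨hb, hb'⟩⟩
  simp only [Finset.mem_inter, id] at hr hrmin
  have hrV : r ∈ vertexSet I J := Finset.mem_union_left _ hr.1
  -- Root the tree at the first vertex `r` of `I ∩ P`. An edge `(a, b)` joins `a` to its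
  -- parent if `a ∉ P`, and `b` to its parent otherwise.
  have hcard : (graphIJ I J).card ≤ ((vertexSet I J).erase r).card := by
    refine Finset.card_le_card_of_injOn (fun e => if e.1 ∈ P then e.2 else e.1) ?_ ?_
    · rintro ⟨a, b⟩ hab
      obtain ⟨ha, hb, hlt, -⟩ := mem_graphIJ.1 hab
      simp only [Finset.mem_coe, Finset.mem_erase]
      split_ifs with haP
      · exact ⟨((hrmin a ⟨ha, haP⟩).trans_lt hlt).ne', Finset.mem_union_right _ hb⟩
      · exact ⟨fun he => haP (he ▸ hr.2), Finset.mem_union_left _ ha⟩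
    · rintro ⟨a, b⟩ hab ⟨a', b'⟩ hab' heq
      obtain ⟨ha, hb, hlt, hno⟩ := mem_graphIJ.1 hab
      obtain ⟨ha', hb', hlt', hno'⟩ := mem_graphIJ.1 hab'
      have key : ∀ {x y}, x ∉ P → x ∈ I → y ∈ P → x < y →
          (∀ c ∈ I, c ∈ P → ¬ (x < c ∧ c < y)) → y ∈ I := by
        intro x y hx hxI hy hxy hno
        obtain ⟨c, hc, hc', h₁, h₂⟩ := exists_mem_inter_between hxI hy hxy.le
        rcases h₁.eq_or_lt with rfl | h₁
        · exact absurd hc' hx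
        · rcases h₂.eq_or_lt with rfl | h₂
          · exact hc
          · exact absurd ⟨h₁, h₂⟩ (hno c hc hc')
      simp only at heq
      split_ifs at heq with h₁ h₂ h₂
      · subst heq
        rcases lt_trichotomy a a' with h | rfl | h
        · exact absurd ⟨h, hlt'⟩ (hno a' ha' h₂)
        · rfl
        · exact absurd ⟨h, hlt⟩ (hno' a ha h₁)
      · exact absurd (heq ▸ hb) h₂
      · exact absurd (heq ▸ hb') h₁
      · subst heq
        have hbI := key h₁ ha hb hlt hno
        have hbI' := key h₁ ha hb' hlt' hno'
        rcases lt_trichotomy b b' with h | rfl | h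
        · exact absurd ⟨hlt, h⟩ (hno' b hbI hb)
        · rfl
        · exact absurd ⟨hlt', h⟩ (hno b' hbI' hb')
  rw [Finset.card_erase_of_mem hrV] at hcard
  have := Finset.card_pos.2 ⟨r, hrV⟩
  omega

theorem graphIJ_isSpanningTree {n : ℕ} {I J : Finset (Fin n)} (h : IsValidPair I J) :
    IsSpanningTree (vertexSet I J) (graphIJ I J) where
  lt := fun e he => (mem_graphIJ.1 he).2.2.1
  mem := fun e he => ⟨Finset.mem_union_left _ (mem_graphIJ.1 he).1,
    Finset.mem_union_right _ (mem_graphIJ.1 he).2.1⟩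
  nonempty := by
    obtain ⟨i, hi, -⟩ := h.exists_min
    exact ⟨i, Finset.mem_union_left _ hi⟩
  card_le := graphIJ_card_lt h
  const := by
    intro c hc
    obtain ⟨i, hi, hmin⟩ := h.exists_min
    obtain ⟨p, hp, hmax⟩ := h.exists_max
    have harc : ∀ a ∈ I, ∀ b ∈ J.image (prec I J), a ≤ b → c a = c b := by
      intro a ha b hb hab
      rcases hab.eq_or_lt with rfl | hab
      · rfl
      · exact arc_induction (Q := fun a b => c a = c b) (fun a b hab => hc _ hab)
          (fun _ _ _ _ _ h₁ h₂ => h₁.trans h₂) ha hb hab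
    have key : ∀ v ∈ vertexSet I J, c i = c v := by
      intro v hv
      rcases Finset.mem_union.1 hv with hv' | hv'
      · exact (harc i hi p hp (hmin p (Finset.mem_union_right _ hp))).trans
          (harc v hv' p hp (hmax v hv)).symm
      · exact harc i hi v hv' (hmin v hv)
    intro u hu v hv
    exact (key u hu).symm.trans (key v hv)

/-! ### Reductions of graphs -/

theorem exists_isLongestPair {n : ℕ} {H : Finset (Fin n × Fin n)} (h : ¬ IsAlternating H) :
    ∃ i j k, IsLongestPair H i j k := by
  simp only [IsAlternating, not_forall, not_not] at h
  obtain ⟨i, j, k, hij, hjk, h₁, h₂⟩ := h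
  obtain ⟨a, ha, hamin⟩ := (Finset.univ.filter fun a => (a, j) ∈ H).exists_min_image id
    ⟨i, by simpa using h₁⟩
  obtain ⟨b, hb, hbmax⟩ := (Finset.univ.filter fun b => (j, b) ∈ H).exists_max_image id
    ⟨k, by simpa using h₂⟩
  simp only [Finset.mem_filter, Finset.mem_univ, true_and, id] at ha hamin hb hbmax
  exact ⟨a, j, b, (hamin i h₁).trans_lt hij, hjk.trans_le (hbmax k h₂), ha, hb,
    fun x hx hxj => (hamin x hxj).not_gt hx, fun x hx hxj => (hbmax x hxj).not_gt hx⟩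

/-- The total deficiency of the lengths of the edges; it decreases in each reduction. -/
def deficiency {n : ℕ} (H : Finset (Fin n × Fin n)) : ℕ :=
  ∑ e ∈ H, (n - (e.2.val - e.1.val))

theorem deficiency_sdiff_union_lt {n : ℕ} {H : Finset (Fin n × Fin n)} {i j k : Fin n}
    {A : Finset (Fin n × Fin n)} (h : IsLongestPair H i j k) {e : Fin n × Fin n} (he : e ∈ A)
    (heij : e = (i, j) ∨ e = (j, k)) : deficiency ((H \ A) ∪ {(i, k)}) < deficiency H := by
  obtain ⟨hij, hjk, hij', hjk', -⟩ := h
  have heH : e ∈ H := by rcases heij with rfl | rfl <;> assumption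
  have h₁ : deficiency ((H \ A) ∪ {(i, k)}) ≤ deficiency (H.erase e) + (n - (k.val - i.val)) := by
    have hsub : H \ A ⊆ H.erase e := fun x hx =>
      Finset.mem_erase.2 ⟨fun h => (Finset.mem_sdiff.1 hx).2 (by rwa [h]), (Finset.mem_sdiff.1 hx).1⟩
    have h := Finset.sum_union_inter (s₁ := H \ A) (s₂ := {(i, k)})
      (f := fun e : Fin n × Fin n => n - (e.2.val - e.1.val))
    rw [Finset.sum_singleton] at h
    exact (Nat.le_add_right _ _).trans (h.le.trans
      (Nat.add_le_add_right (Finset.sum_le_sum_of_subset hsub) _))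
  have h₂ : deficiency (H.erase e) + (n - (e.2.val - e.1.val)) = deficiency H :=
    Finset.sum_erase_add _ _ heH
  have h₃ : n - (k.val - i.val) < n - (e.2.val - e.1.val) := by
    have := k.isLt
    rcases heij with rfl | rfl <;> simp only [Fin.lt_def] at * <;> omega
  omega

theorem deficiency_reduction₁_lt {n : ℕ} {H : Finset (Fin n × Fin n)} {i j k : Fin n}
    (h : IsLongestPair H i j k) : deficiency (reduction₁ H i j k) < deficiency H :=
  deficiency_sdiff_union_lt h (Finset.mem_singleton_self _) (Or.inr rfl)

theorem deficiency_reduction₂_lt {n : ℕ} {H : Finset (Fin n × Fin n)} {i j k : Fin n}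
    (h : IsLongestPair H i j k) : deficiency (reduction₂ H i j k) < deficiency H :=
  deficiency_sdiff_union_lt h (Finset.mem_singleton_self _) (Or.inl rfl)

theorem deficiency_reduction₃_lt {n : ℕ} {H : Finset (Fin n × Fin n)} {i j k : Fin n}
    (h : IsLongestPair H i j k) : deficiency (reduction₃ H i j k) < deficiency H :=
  deficiency_sdiff_union_lt h (Finset.mem_insert_self _ _) (Or.inl rfl)

theorem nonempty_longestReductionTree {n : ℕ} (H : Finset (Fin n × Fin n)) :
    Nonempty (LongestReductionTree H) := by
  by_cases hH : IsAlternating H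
  · exact ⟨.leaf H hH⟩
  · obtain ⟨i, j, k, h⟩ := exists_isLongestPair hH
    obtain ⟨t₁⟩ := nonempty_longestReductionTree (reduction₁ H i j k)
    obtain ⟨t₂⟩ := nonempty_longestReductionTree (reduction₂ H i j k)
    obtain ⟨t₃⟩ := nonempty_longestReductionTree (reduction₃ H i j k)
    exact ⟨.node H i j k h t₁ t₂ t₃⟩
termination_by deficiency H
decreasing_by
  · exact deficiency_reduction₁_lt h
  · exact deficiency_reduction₂_lt h
  · exact deficiency_reduction₃_lt h

/-- An edge that crosses the new edge `(i, k)` crosses `(i, j)` or `(j, k)`, or is an edge `(j, b)` with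
`k < b` or an edge `(a, j)` with `a < i`. -/
theorem IsNonCrossing.sdiff_union {n : ℕ} {H : Finset (Fin n × Fin n)} (hH : IsNonCrossing H)
    {i j k : Fin n} (h : IsLongestPair H i j k) (A : Finset (Fin n × Fin n)) :
    IsNonCrossing ((H \ A) ∪ {(i, k)}) := by
  obtain ⟨hij, hjk, hij', hjk', hmin, hmax⟩ := h
  have h₁ : ∀ a b, (a, b) ∈ H → ¬ (i < a ∧ a < k ∧ k < b) := by
    rintro a b hab ⟨h₁, h₂, h₃⟩
    rcases lt_trichotomy a j with h | rfl | h
    · exact hH _ _ _ _ hij' hab ⟨h₁, h, hjk.trans h₃⟩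
    · exact hmax b h₃ hab
    · exact hH _ _ _ _ hjk' hab ⟨h, h₂, h₃⟩
  have h₂ : ∀ a b, (a, b) ∈ H → ¬ (a < i ∧ i < b ∧ b < k) := by
    rintro a b hab ⟨h₁, h₂, h₃⟩
    rcases lt_trichotomy b j with h | rfl | h
    · exact hH _ _ _ _ hab hij' ⟨h₁, h₂, h⟩
    · exact hmin a h₁ hab
    · exact hH _ _ _ _ hab hjk' ⟨h₁.trans hij, h, h₃⟩
  intro a b a' b' hab hab' hcross
  simp only [Finset.mem_union, Finset.mem_sdiff, Finset.mem_singleton, Prod.mk.injEq] at hab hab'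
  rcases hab with ⟨hab, -⟩ | ⟨rfl, rfl⟩ <;> rcases hab' with ⟨hab', -⟩ | ⟨rfl, rfl⟩
  · exact hH _ _ _ _ hab hab' hcross
  · exact h₂ _ _ hab hcross
  · exact h₁ _ _ hab' hcross
  · exact lt_irrefl _ hcross.1

theorem mem_reduction₁ {n : ℕ} {H : Finset (Fin n × Fin n)} {i j k : Fin n} {e : Fin n × Fin n} :
    e ∈ reduction₁ H i j k ↔ (e ∈ H ∧ e ≠ (j, k)) ∨ e = (i, k) := by
  simp [reduction₁, or_comm]

theorem mem_reduction₂ {n : ℕ} {H : Finset (Fin n × Fin n)} {i j k : Fin n} {e : Fin n × Fin n} :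
    e ∈ reduction₂ H i j k ↔ (e ∈ H ∧ e ≠ (i, j)) ∨ e = (i, k) := by
  simp [reduction₂, or_comm]

theorem mem_reduction₃ {n : ℕ} {H : Finset (Fin n × Fin n)} {i j k : Fin n} {e : Fin n × Fin n} :
    e ∈ reduction₃ H i j k ↔ (e ∈ H ∧ e ≠ (i, j) ∧ e ≠ (j, k)) ∨ e = (i, k) := by
  simp [reduction₃, or_comm]

theorem card_sdiff_union_singleton_le {n : ℕ} {H A : Finset (Fin n × Fin n)} (hA : A ⊆ H)
    (e : Fin n × Fin n) : ((H \ A) ∪ {e}).card + A.card ≤ H.card + 1 := by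
  have h₁ := Finset.card_union_le (H \ A) {e}
  have h₂ := Finset.card_sdiff_add_card_eq_card hA
  rw [Finset.card_singleton] at h₁
  omega

theorem card_reduction₁_le {n : ℕ} {H : Finset (Fin n × Fin n)} {i j k : Fin n}
    (hjk : (j, k) ∈ H) : (reduction₁ H i j k).card ≤ H.card := by
  simpa [reduction₁] using
    card_sdiff_union_singleton_le (Finset.singleton_subset_iff.2 hjk) (i, k)

theorem card_reduction₂_le {n : ℕ} {H : Finset (Fin n × Fin n)} {i j k : Fin n}
    (hij : (i, j) ∈ H) : (reduction₂ H i j k).card ≤ H.card := by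
  simpa [reduction₂] using
    card_sdiff_union_singleton_le (Finset.singleton_subset_iff.2 hij) (i, k)

theorem card_reduction₃_lt {n : ℕ} {H : Finset (Fin n × Fin n)} {i j k : Fin n}
    (h : IsLongestPair H i j k) : (reduction₃ H i j k).card < H.card := by
  have hne : (i, j) ≠ (j, k) := fun he => h.1.ne (Prod.ext_iff.1 he).1
  have h' := card_sdiff_union_singleton_le (H := H) (A := {(i, j), (j, k)})
    (Finset.insert_subset h.2.2.1 (Finset.singleton_subset_iff.2 h.2.2.2.1)) (i, k)
  rw [Finset.card_pair hne] at h'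
  change _ < _
  unfold reduction₃
  omega

theorem IsSpanningTree.reduction₁ {n : ℕ} {V : Finset (Fin n)} {H : Finset (Fin n × Fin n)}
    (h : IsSpanningTree V H) {i j k : Fin n} (hij : (i, j) ∈ H) (hjk : (j, k) ∈ H) :
    IsSpanningTree V (reduction₁ H i j k) where
  lt := by
    intro e he
    rcases mem_reduction₁.1 he with he | rfl
    · exact h.lt e he.1
    · exact (h.lt _ hij).trans (h.lt _ hjk)
  mem := by
    intro e he
    rcases mem_reduction₁.1 he with he | rfl
    · exact h.mem e he.1
    · exact ⟨(h.mem _ hij).1, (h.mem _ hjk).2⟩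
  nonempty := h.nonempty
  card_le := (Nat.add_le_add_right (card_reduction₁_le hjk) 1).trans h.card_le
  const := by
    intro c hc
    refine h.const c fun e he => ?_
    by_cases hek : e = (j, k)
    · subst hek
      have hij' := hc (i, j) (mem_reduction₁.2 (Or.inl ⟨hij, fun he =>
        (h.lt _ hij).ne (Prod.ext_iff.1 he).1⟩))
      exact hij'.symm.trans (hc (i, k) (mem_reduction₁.2 (Or.inr rfl)))
    · exact hc e (mem_reduction₁.2 (Or.inl ⟨he, hek⟩))

theorem IsSpanningTree.reduction₂ {n : ℕ} {V : Finset (Fin n)} {H : Finset (Fin n × Fin n)}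
    (h : IsSpanningTree V H) {i j k : Fin n} (hij : (i, j) ∈ H) (hjk : (j, k) ∈ H) :
    IsSpanningTree V (reduction₂ H i j k) where
  lt := by
    intro e he
    rcases mem_reduction₂.1 he with he | rfl
    · exact h.lt e he.1
    · exact (h.lt _ hij).trans (h.lt _ hjk)
  mem := by
    intro e he
    rcases mem_reduction₂.1 he with he | rfl
    · exact h.mem e he.1
    · exact ⟨(h.mem _ hij).1, (h.mem _ hjk).2⟩
  nonempty := h.nonempty
  card_le := (Nat.add_le_add_right (card_reduction₂_le hij) 1).trans h.card_le
  const := by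
    intro c hc
    refine h.const c fun e he => ?_
    by_cases hek : e = (i, j)
    · subst hek
      have hjk' := hc (j, k) (mem_reduction₂.2 (Or.inl ⟨hjk, fun he =>
        (h.lt _ hij).ne' (Prod.ext_iff.1 he).1⟩))
      exact (hc (i, k) (mem_reduction₂.2 (Or.inr rfl))).trans hjk'.symm
    · exact hc e (mem_reduction₂.2 (Or.inl ⟨he, hek⟩))

theorem IsSpanningTree.card_eq {n : ℕ} {V : Finset (Fin n)} {H : Finset (Fin n × Fin n)}
    (h : IsSpanningTree V H) : H.card + 1 = V.card :=
  le_antisymm h.card_le (card_le_card_add_one_of_const h.lt h.mem h.nonempty h.const)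

/-- The full-dimensional leaves of a reduction tree whose root is a non-crossing spanning tree with edges
from `I` to `P` are alternating graphs with the same properties. -/
theorem LongestReductionTree.leaves_spec {n : ℕ} {V I P : Finset (Fin n)}
    {H : Finset (Fin n × Fin n)} (R : LongestReductionTree H) :
    IsSpanningTree V H → IsNonCrossing H → (∀ e ∈ H, e.1 ∈ I ∧ e.2 ∈ P) →
      ∀ L ∈ R.leaves, L.card = H.card →
        IsSpanningTree V L ∧ IsNonCrossing L ∧ (∀ e ∈ L, e.1 ∈ I ∧ e.2 ∈ P) ∧ IsAlternating L := by
  induction R with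
  | leaf H h =>
    intro hT hN hIP L hL _
    rw [show L = H from hL]
    exact ⟨hT, hN, hIP, h⟩
  | node H i j k h t₁ t₂ t₃ ih₁ ih₂ ih₃ =>
    intro hT hN hIP L hL hcard
    have hij := h.2.2.1
    have hjk := h.2.2.2.1
    have hIP' : ∀ e, e ∈ H ∨ e = (i, k) → e.1 ∈ I ∧ e.2 ∈ P := by
      rintro e (he | rfl)
      · exact hIP e he
      · exact ⟨(hIP _ hij).1, (hIP _ hjk).2⟩
    have hT₁ := hT.reduction₁ hij hjk
    have hT₂ := hT.reduction₂ hij hjk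
    rcases hL with (hL | hL) | hL
    · refine ih₁ hT₁ (hN.sdiff_union h _) (fun e he => hIP' e ?_) L hL ?_
      · exact (mem_reduction₁.1 he).imp_left And.left
      · have := hT.card_eq
        have := hT₁.card_eq
        omega
    · refine ih₂ hT₂ (hN.sdiff_union h _) (fun e he => hIP' e ?_) L hL ?_
      · exact (mem_reduction₂.1 he).imp_left And.left
      · have := hT.card_eq
        have := hT₂.card_eq
        omega
    · have hle : ∀ {H : Finset (Fin n × Fin n)} (R : LongestReductionTree H), ∀ L ∈ R.leaves,
          L.card ≤ H.card := by
        intro H R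
        induction R with
        | leaf H h => exact fun L hL => (congrArg Finset.card (show L = H from hL)).le
        | node H i j k h t₁ t₂ t₃ ih₁ ih₂ ih₃ =>
          rintro L ((hL | hL) | hL)
          · exact (ih₁ L hL).trans (card_reduction₁_le h.2.2.2.1)
          · exact (ih₂ L hL).trans (card_reduction₂_le h.2.2.1)
          · exact (ih₃ L hL).trans (card_reduction₃_lt h).le
      have := hle t₃ L hL
      have := card_reduction₃_lt h
      omega

/-! ### Flows -/

/-- The net flow of the multiset `f` of edges: the number of edges that leave a vertex minus the number of
edges that enter it. A multiset of edges is thought of as a flow with values in `ℕ`. -/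
def netFlow {n : ℕ} (f : Multiset (Fin n × Fin n)) (v : Fin n) : ℤ :=
  (f.map Prod.fst).count v - (f.map Prod.snd).count v

theorem netFlow_add {n : ℕ} (f g : Multiset (Fin n × Fin n)) :
    netFlow (f + g) = netFlow f + netFlow g := by
  ext v
  simp only [netFlow, Multiset.map_add, Multiset.count_add, Pi.add_apply]
  push_cast
  ring

theorem netFlow_cons {n : ℕ} (e : Fin n × Fin n) (f : Multiset (Fin n × Fin n)) :
    netFlow (e ::ₘ f) = netFlow {e} + netFlow f := by
  rw [← Multiset.singleton_add, netFlow_add]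

theorem netFlow_singleton_add {n : ℕ} (i j k : Fin n) :
    netFlow {(i, j)} + netFlow {(j, k)} = netFlow {(i, k)} := by
  ext v
  simp only [netFlow, Multiset.map_singleton, Pi.add_apply]
  ring

theorem netFlow_of_not_source {n : ℕ} {f : Multiset (Fin n × Fin n)} {v : Fin n}
    (h : ∀ w, (v, w) ∉ f) : netFlow f v = -((f.map Prod.snd).count v : ℤ) := by
  have h' : (f.map Prod.fst).count v = 0 := Multiset.count_eq_zero.2 fun hv => by
    obtain ⟨⟨a, w⟩, he, rfl⟩ := Multiset.mem_map.1 hv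
    exact h w he
  rw [netFlow, h']
  simp

theorem netFlow_of_not_target {n : ℕ} {f : Multiset (Fin n × Fin n)} {v : Fin n}
    (h : ∀ w, (w, v) ∉ f) : netFlow f v = (f.map Prod.fst).count v := by
  have h' : (f.map Prod.snd).count v = 0 := Multiset.count_eq_zero.2 fun hv => by
    obtain ⟨⟨w, a⟩, he, rfl⟩ := Multiset.mem_map.1 hv
    exact h w he
  rw [netFlow, h']
  simp

/-- In an alternating graph no vertex has both outgoing and incoming edges, so the sign of the net flow
tells which vertices have outgoing edges in the flow. -/
theorem netFlow_pos_iff {n : ℕ} {f : Multiset (Fin n × Fin n)}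
    (ha : ∀ i j k, (i, j) ∈ f → (j, k) ∉ f) (v : Fin n) : 0 < netFlow f v ↔ ∃ w, (v, w) ∈ f := by
  constructor
  · intro h
    by_contra! hv
    rw [netFlow_of_not_source hv] at h
    omega
  · rintro ⟨w, hw⟩
    rw [netFlow_of_not_target fun u hu => ha u v w hu hw]
    exact_mod_cast Multiset.count_pos.2 (Multiset.mem_map_of_mem Prod.fst hw)

theorem netFlow_neg_iff {n : ℕ} {f : Multiset (Fin n × Fin n)}
    (ha : ∀ i j k, (i, j) ∈ f → (j, k) ∉ f) (v : Fin n) : netFlow f v < 0 ↔ ∃ w, (w, v) ∈ f := by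
  constructor
  · intro h
    by_contra! hv
    rw [netFlow_of_not_target hv] at h
    omega
  · rintro ⟨w, hw⟩
    rw [netFlow_of_not_source fun u hu => ha w v u hw hu, neg_neg_iff_pos]
    exact_mod_cast Multiset.count_pos.2 (Multiset.mem_map_of_mem Prod.snd hw)

/-- If `v` is the first sink and `u` the last source before `v`, then every alternating non-crossing flow
sends something along `(u, v)`: otherwise an edge into `v` and an edge out of `u` cross. -/
theorem edge_mem_of_adjacent {n : ℕ} {f : Multiset (Fin n × Fin n)} (hlt : ∀ e ∈ f, e.1 < e.2)
    (ha : ∀ i j k, (i, j) ∈ f → (j, k) ∉ f)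
    (hn : ∀ i j i' j', (i, j) ∈ f → (i', j') ∈ f → ¬ (i < i' ∧ i' < j ∧ j < j')) {u v : Fin n}
    (hu : 0 < netFlow f u) (hv : netFlow f v < 0) (huv : u < v)
    (hvmin : ∀ w, netFlow f w < 0 → v ≤ w) (humax : ∀ w, w < v → 0 < netFlow f w → w ≤ u) :
    (u, v) ∈ f := by
  obtain ⟨z, hz⟩ := (netFlow_pos_iff ha u).1 hu
  obtain ⟨w, hw⟩ := (netFlow_neg_iff ha v).1 hv
  rcases (hvmin z ((netFlow_neg_iff ha z).2 ⟨u, hz⟩)).eq_or_lt with rfl | hvz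
  · exact hz
  rcases (humax w (hlt _ hw) ((netFlow_pos_iff ha w).2 ⟨v, hw⟩)).eq_or_lt with rfl | hwu
  · exact hw
  · exact absurd ⟨hwu, huv, hvz⟩ (hn _ _ _ _ hw hz)

/-- An alternating non-crossing flow is determined by its net flow: like a system of parentheses, it has
only one non-crossing matching of the sources with the sinks. -/
theorem eq_of_netFlow_eq {n : ℕ} (f : Multiset (Fin n × Fin n)) :
    ∀ g : Multiset (Fin n × Fin n), (∀ e ∈ f, e.1 < e.2) → (∀ e ∈ g, e.1 < e.2) →
    (∀ i j k, (i, j) ∈ f → (j, k) ∉ f) → (∀ i j k, (i, j) ∈ g → (j, k) ∉ g) →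
    (∀ i j i' j', (i, j) ∈ f → (i', j') ∈ f → ¬ (i < i' ∧ i' < j ∧ j < j')) →
    (∀ i j i' j', (i, j) ∈ g → (i', j') ∈ g → ¬ (i < i' ∧ i' < j ∧ j < j')) →
    netFlow f = netFlow g → f = g := by
  induction hN : f.card generalizing f with
  | zero =>
    intro g _ hg _ ha' _ _ hfg
    rw [Multiset.card_eq_zero] at hN
    subst hN
    symm
    refine Multiset.eq_zero_of_forall_notMem ?_
    rintro ⟨a, b⟩ hab
    have h := (netFlow_pos_iff ha' a).2 ⟨b, hab⟩
    rw [← hfg] at h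
    simp [netFlow] at h
  | succ N ih =>
    intro g hf hg ha ha' hn hn' hfg
    obtain ⟨⟨a₀, b₀⟩, h₀⟩ := Multiset.card_pos_iff_exists_mem.1 (by omega : 0 < f.card)
    obtain ⟨v, hv, hvmin⟩ := (Finset.univ.filter fun v => netFlow f v < 0).exists_min_image id
      ⟨b₀, by simpa using (netFlow_neg_iff ha b₀).2 ⟨a₀, h₀⟩⟩
    simp only [Finset.mem_filter, Finset.mem_univ, true_and, id] at hv hvmin
    obtain ⟨w, hw⟩ := (netFlow_neg_iff ha v).1 hv
    obtain ⟨u, hu, humax⟩ :=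
      (Finset.univ.filter fun u => u < v ∧ 0 < netFlow f u).exists_max_image id
        ⟨w, by simpa using ⟨hf _ hw, (netFlow_pos_iff ha w).2 ⟨v, hw⟩⟩⟩
    simp only [Finset.mem_filter, Finset.mem_univ, true_and, id] at hu humax
    have h₁ : (u, v) ∈ f := edge_mem_of_adjacent hf ha hn hu.2 hv hu.1 hvmin
      fun w h h' => humax w ⟨h, h'⟩
    have h₂ : (u, v) ∈ g := by
      rw [hfg] at hu hv hvmin humax
      exact edge_mem_of_adjacent hg ha' hn' hu.2 hv hu.1 hvmin fun w h h' => humax w ⟨h, h'⟩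
    obtain ⟨f', rfl⟩ := Multiset.exists_cons_of_mem h₁
    obtain ⟨g', rfl⟩ := Multiset.exists_cons_of_mem h₂
    rw [netFlow_cons, netFlow_cons (u, v) g', add_right_inj] at hfg
    have hs : ∀ {e} {f : Multiset (Fin n × Fin n)}, e ∈ f → e ∈ (u, v) ::ₘ f :=
      Multiset.mem_cons_of_mem
    rw [ih f' (by simpa using hN) g' (fun e h => hf e (hs h)) (fun e h => hg e (hs h))
      (fun i j k h h' => ha i j k (hs h) (hs h')) (fun i j k h h' => ha' i j k (hs h) (hs h'))
      (fun i j i' j' h h' => hn i j i' j' (hs h) (hs h'))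
      (fun i j i' j' h h' => hn' i j i' j' (hs h) (hs h')) hfg]

/-- A flow on `H` can be moved to the first or the second reduction of `H`: as long as both `(i, j)` and
`(j, k)` carry flow, a unit on this path is replaced by a unit on `(i, k)`. -/
theorem exists_flow_reduction {n : ℕ} {H : Finset (Fin n × Fin n)} {i j k : Fin n}
    (hij : i ≠ j) (f : Multiset (Fin n × Fin n)) (hf : ∀ e ∈ f, e ∈ H ∨ e = (i, k)) :
    ∃ g, netFlow g = netFlow f ∧
      ((∀ e ∈ g, e ∈ reduction₁ H i j k) ∨ (∀ e ∈ g, e ∈ reduction₂ H i j k)) := by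
  induction hN : f.card using Nat.strong_induction_on generalizing f with
  | _ N ih =>
    by_cases hjk : (j, k) ∈ f
    swap
    · exact ⟨f, rfl, Or.inl fun e he => mem_reduction₁.2 ((hf e he).imp_left fun h =>
        ⟨h, fun h' => hjk (h' ▸ he)⟩)⟩
    obtain ⟨f', rfl⟩ := Multiset.exists_cons_of_mem hjk
    by_cases hij' : (i, j) ∈ (j, k) ::ₘ f'
    swap
    · exact ⟨_, rfl, Or.inr fun e he => mem_reduction₂.2 ((hf e he).imp_left fun h =>
        ⟨h, fun h' => hij' (h' ▸ he)⟩)⟩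
    rcases Multiset.mem_cons.1 hij' with heq | hij'
    · exact absurd (Prod.ext_iff.1 heq).1 hij
    · obtain ⟨f'', rfl⟩ := Multiset.exists_cons_of_mem hij'
      obtain ⟨g, hg, hg'⟩ := ih _ (by subst hN; simp) ((i, k) ::ₘ f'') (fun e he => by
        rcases Multiset.mem_cons.1 he with rfl | he
        · exact Or.inr rfl
        · exact hf e (Multiset.mem_cons_of_mem (Multiset.mem_cons_of_mem he))) rfl
      refine ⟨g, ?_, hg'⟩
      rw [hg, netFlow_cons, netFlow_cons (j, k), netFlow_cons (i, j), ← netFlow_singleton_add i j k]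
      abel

/-- Every flow on the root of a reduction tree can be moved to a leaf that is reached by first and second
reductions only. -/
theorem LongestReductionTree.exists_leaf_flow {n : ℕ} {V : Finset (Fin n)}
    {H : Finset (Fin n × Fin n)} (R : LongestReductionTree H) :
    IsSpanningTree V H → ∀ f : Multiset (Fin n × Fin n), (∀ e ∈ f, e ∈ H) →
      ∃ L ∈ R.leaves, L.card = H.card ∧ ∃ g, netFlow g = netFlow f ∧ ∀ e ∈ g, e ∈ L := by
  induction R with
  | leaf H h => exact fun _ f hf => ⟨H, rfl, rfl, f, rfl, hf⟩
  | node H i j k h t₁ t₂ t₃ ih₁ ih₂ ih₃ =>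
    intro hT f hf
    have hij := h.2.2.1
    have hjk := h.2.2.2.1
    obtain ⟨g, hg, hgr⟩ := exists_flow_reduction (H := H) (i := i) (j := j) (k := k) h.1.ne f
      fun e he => Or.inl (hf e he)
    rcases hgr with hgr | hgr
    · have hT' := hT.reduction₁ hij hjk
      obtain ⟨L, hL, hc, g', hg', hL'⟩ := ih₁ hT' g hgr
      refine ⟨L, Or.inl (Or.inl hL), ?_, g', hg'.trans hg, hL'⟩
      have := hT.card_eq
      have := hT'.card_eq
      omega
    · have hT' := hT.reduction₂ hij hjk
      obtain ⟨L, hL, hc, g', hg', hL'⟩ := ih₂ hT' g hgr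
      refine ⟨L, Or.inl (Or.inr hL), ?_, g', hg'.trans hg, hL'⟩
      have := hT.card_eq
      have := hT'.card_eq
      omega

/-! ### Full-dimensional leaves -/

theorem exists_flow_graphIJ {n : ℕ} {I J : Finset (Fin n)} (f : Multiset (Fin n × Fin n))
    (hf : ∀ e ∈ f, e.1 < e.2 ∧ e.1 ∈ I ∧ e.2 ∈ J.image (prec I J)) :
    ∃ g, netFlow g = netFlow f ∧ ∀ e ∈ g, e ∈ graphIJ I J := by
  induction f using Multiset.induction_on with
  | empty => exact ⟨0, rfl, by simp⟩
  | cons e f ih =>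
    obtain ⟨g, hg, hgG⟩ := ih fun e he => hf e (Multiset.mem_cons_of_mem he)
    obtain ⟨hlt, hI, hP⟩ := hf e (Multiset.mem_cons_self e f)
    obtain ⟨p, hp, hpG⟩ := arc_induction (Q := fun a b => ∃ p : Multiset (Fin n × Fin n),
      netFlow p = netFlow {(a, b)} ∧ ∀ e ∈ p, e ∈ graphIJ I J)
      (fun a b hab => ⟨{(a, b)}, rfl, by simpa using hab⟩)
      (fun a b c _ _ ⟨p, hp, hpG⟩ ⟨q, hq, hqG⟩ => ⟨p + q, by
        rw [netFlow_add, hp, hq, netFlow_singleton_add], fun e he =>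
        (Multiset.mem_add.1 he).elim (hpG e) (hqG e)⟩) hI hP hlt
    exact ⟨p + g, by rw [netFlow_add, netFlow_cons, hp, hg], fun e he =>
      (Multiset.mem_add.1 he).elim (hpG e) (hgG e)⟩

theorem IsAltNonCrossing.eq_of_netFlow_eq {n : ℕ} {I J : Finset (Fin n)}
    {D L : Finset (Fin n × Fin n)} (hD : IsAltNonCrossing I J D) (hL : IsAltNonCrossing I J L)
    {f g : Multiset (Fin n × Fin n)} (hf : ∀ e ∈ f, e ∈ D) (hg : ∀ e ∈ g, e ∈ L)
    (h : netFlow f = netFlow g) : f = g :=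
  IJTamari.eq_of_netFlow_eq f g (fun e he => (hD.1 e (hf e he)).1) (fun e he => (hL.1 e (hg e he)).1)
    (fun i j k h h' => hD.2.1 i j k (hD.1 _ (hf _ h)).1 (hD.1 _ (hf _ h')).1 (hf _ h) (hf _ h'))
    (fun i j k h h' => hL.2.1 i j k (hL.1 _ (hg _ h)).1 (hL.1 _ (hg _ h')).1 (hg _ h) (hg _ h'))
    (fun i j i' j' h h' => hD.2.2 i j i' j' (hf _ h) (hf _ h'))
    (fun i j i' j' h h' => hL.2.2 i j i' j' (hg _ h) (hg _ h')) h

theorem LongestReductionTree.fullDimensionalLeaves_spec {n : ℕ} {I J : Finset (Fin n)}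
    (hIJ : IsValidPair I J) (R : LongestReductionTree (graphIJ I J)) {L : Finset (Fin n × Fin n)}
    (hL : L ∈ R.fullDimensionalLeaves) :
    IsSpanningTree (vertexSet I J) L ∧ IsAltNonCrossing I J L := by
  obtain ⟨h₁, h₂, h₃, h₄⟩ := R.leaves_spec (graphIJ_isSpanningTree hIJ) (graphIJ_isNonCrossing I J)
    (fun e he => ⟨(mem_graphIJ.1 he).1, (mem_graphIJ.1 he).2.1⟩) L hL.1 hL.2
  exact ⟨h₁, fun e he => ⟨h₁.lt e he, h₃ e he⟩, h₄, h₂⟩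

/-- A maximal alternating non-crossing graph `D` is a leaf: the flow with one unit on each edge of `D` moves
to `G(I, J̄)`, hence to a leaf, where it must be the same flow. -/
theorem LongestReductionTree.mem_fullDimensionalLeaves {n : ℕ} {I J : Finset (Fin n)}
    (hIJ : IsValidPair I J) (R : LongestReductionTree (graphIJ I J)) {D : Finset (Fin n × Fin n)}
    (hD : D ∈ maximalAltNonCrossing I J) : D ∈ R.fullDimensionalLeaves := by
  obtain ⟨f, hf, hfG⟩ := exists_flow_graphIJ D.val hD.prop.1
  obtain ⟨L, hL, hcard, g, hg, hgL⟩ := R.exists_leaf_flow (graphIJ_isSpanningTree hIJ) f hfG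
  have hLA := (R.fullDimensionalLeaves_spec hIJ ⟨hL, hcard⟩).2
  have hgD : D.val = g :=
    hD.prop.eq_of_netFlow_eq hLA (fun e he => he) hgL (hg.trans hf).symm
  have hDL : D ⊆ L := fun e he => hgL e (hgD ▸ he)
  rw [hD.eq_of_le hLA hDL]
  exact ⟨hL, hcard⟩

theorem LongestReductionTree.fullDimensionalLeaves_eq {n : ℕ} {I J : Finset (Fin n)}
    (hIJ : IsValidPair I J) (R : LongestReductionTree (graphIJ I J)) :
    R.fullDimensionalLeaves = maximalAltNonCrossing I J := by
  refine Set.Subset.antisymm (fun L hL => ?_) fun D hD => R.mem_fullDimensionalLeaves hIJ hD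
  obtain ⟨D, hLD, hD⟩ := (Set.toFinite {H | IsAltNonCrossing I J H}).exists_le_maximal
    (R.fullDimensionalLeaves_spec hIJ hL).2
  have h := (R.mem_fullDimensionalLeaves hIJ hD).2.trans hL.2.symm
  rw [Finset.eq_of_subset_of_card_le hLD h.le]
  exact hD

theorem isTreeOn_of_mem_maximalAltNonCrossing {n : ℕ} {I J : Finset (Fin n)}
    (hIJ : IsValidPair I J) {H : Finset (Fin n × Fin n)} (hH : H ∈ maximalAltNonCrossing I J) :
    IsTreeOn (vertexSet I J) H := by
  obtain ⟨R⟩ := nonempty_longestReductionTree (graphIJ I J)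
  exact (R.fullDimensionalLeaves_spec hIJ (R.mem_fullDimensionalLeaves hIJ hH)).1.isTreeOn

/-! ### Confluence of the reductions of longest pairs -/

/-- `H` is non-crossing and contained in a spanning tree of `V`. -/
def IsNonCrossingForest {n : ℕ} (V : Finset (Fin n)) (H : Finset (Fin n × Fin n)) : Prop :=
  IsNonCrossing H ∧ ∃ T, H ⊆ T ∧ IsSpanningTree V T

theorem IsNonCrossingForest.not_mem {n : ℕ} {V : Finset (Fin n)} {H : Finset (Fin n × Fin n)}
    (hH : IsNonCrossingForest V H) {i j k : Fin n} (h : IsLongestPair H i j k) : (i, k) ∉ H := by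
  obtain ⟨-, T, hHT, hT⟩ := hH
  exact fun hik => hT.not_mem (hHT h.2.2.1) (hHT h.2.2.2.1) (hHT hik)

theorem IsNonCrossingForest.reduction₁ {n : ℕ} {V : Finset (Fin n)} {H : Finset (Fin n × Fin n)}
    (hH : IsNonCrossingForest V H) {i j k : Fin n} (h : IsLongestPair H i j k) :
    IsNonCrossingForest V (reduction₁ H i j k) := by
  obtain ⟨hN, T, hHT, hT⟩ := hH
  exact ⟨hN.sdiff_union h _, _, Finset.union_subset_union_left
    (Finset.sdiff_subset_sdiff hHT subset_rfl), hT.reduction₁ (hHT h.2.2.1) (hHT h.2.2.2.1)⟩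

theorem IsNonCrossingForest.reduction₂ {n : ℕ} {V : Finset (Fin n)} {H : Finset (Fin n × Fin n)}
    (hH : IsNonCrossingForest V H) {i j k : Fin n} (h : IsLongestPair H i j k) :
    IsNonCrossingForest V (reduction₂ H i j k) := by
  obtain ⟨hN, T, hHT, hT⟩ := hH
  exact ⟨hN.sdiff_union h _, _, Finset.union_subset_union_left
    (Finset.sdiff_subset_sdiff hHT subset_rfl), hT.reduction₂ (hHT h.2.2.1) (hHT h.2.2.2.1)⟩

theorem IsNonCrossingForest.reduction₃ {n : ℕ} {V : Finset (Fin n)} {H : Finset (Fin n × Fin n)}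
    (hH : IsNonCrossingForest V H) {i j k : Fin n} (h : IsLongestPair H i j k) :
    IsNonCrossingForest V (reduction₃ H i j k) := by
  obtain ⟨hN, T, hHT, hT⟩ := hH
  refine ⟨hN.sdiff_union h _, _, Finset.union_subset_union_left
    (Finset.sdiff_subset_sdiff hHT ?_), hT.reduction₁ (hHT h.2.2.1) (hHT h.2.2.2.1)⟩
  exact Finset.subset_insert _ _

/-- The result of reducing `H` at an arbitrarily chosen longest pair as long as there is one. -/
noncomputable def normalForm {n : ℕ} (H : Finset (Fin n × Fin n)) : Poly n :=
  if h : ∃ p : Fin n × Fin n × Fin n, IsLongestPair H p.1 p.2.1 p.2.2 then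
    normalForm (reduction₁ H h.choose.1 h.choose.2.1 h.choose.2.2) +
      normalForm (reduction₂ H h.choose.1 h.choose.2.1 h.choose.2.2) +
      MvPolynomial.C Polynomial.X *
        normalForm (reduction₃ H h.choose.1 h.choose.2.1 h.choose.2.2)
  else graphMonomial H
termination_by deficiency H
decreasing_by
  · exact deficiency_reduction₁_lt h.choose_spec
  · exact deficiency_reduction₂_lt h.choose_spec
  · exact deficiency_reduction₃_lt h.choose_spec

/-- The normal form of the polynomial obtained from the monomial of `H` by one reduction. -/
noncomputable def reducedSum {n : ℕ} (H : Finset (Fin n × Fin n)) (i j k : Fin n) : Poly n :=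
  normalForm (reduction₁ H i j k) + normalForm (reduction₂ H i j k) +
    MvPolynomial.C Polynomial.X * normalForm (reduction₃ H i j k)

theorem IsLongestPair.unique {n : ℕ} {H : Finset (Fin n × Fin n)} {i i' j k k' : Fin n}
    (h : IsLongestPair H i j k) (h' : IsLongestPair H i' j k') : i = i' ∧ k = k' := by
  obtain ⟨-, -, h₁, h₂, h₃, h₄⟩ := h
  obtain ⟨-, -, h₁', h₂', h₃', h₄'⟩ := h'
  exact ⟨le_antisymm (not_lt.1 fun hlt => h₃ _ hlt h₁') (not_lt.1 fun hlt => h₃' _ hlt h₁),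
    le_antisymm (not_lt.1 fun hlt => h₄' _ hlt h₂) (not_lt.1 fun hlt => h₄ _ hlt h₂')⟩

/-- Reducing at `j` does not affect the longest pair at a later vertex `j'`, unless the two pairs share the
edge `(j, j')`. -/
theorem IsLongestPair.sdiff_union_right {n : ℕ} {H : Finset (Fin n × Fin n)}
    (hN : IsNonCrossing H) {i j k i' j' k' : Fin n} (h : IsLongestPair H i j k)
    (h' : IsLongestPair H i' j' k') (hjj' : j < j') (hne : ¬ (i' = j ∧ k = j'))
    {A : Finset (Fin n × Fin n)} (hA : A ⊆ {(i, j), (j, k)}) :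
    IsLongestPair ((H \ A) ∪ {(i, k)}) i' j' k' := by
  obtain ⟨hij, hjk, h₁, h₂, h₃, h₄⟩ := h
  obtain ⟨hij', hjk', h₁', h₂', h₃', h₄'⟩ := h'
  have hmem : ∀ e, e ∈ A → e = (i, j) ∨ e = (j, k) := fun e he => by simpa using hA he
  simp only [IsLongestPair, Finset.mem_union, Finset.mem_sdiff, Finset.mem_singleton,
    Prod.mk.injEq, not_or, not_and]
  refine ⟨hij', hjk', Or.inl ⟨h₁', fun hm => ?_⟩, Or.inl ⟨h₂', fun hm => ?_⟩, fun a ha =>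
    ⟨fun hm => absurd hm (h₃' a ha), ?_⟩, fun b hb => ⟨fun hm => absurd hm (h₄' b hb), ?_⟩⟩
  · rcases hmem _ hm with he | he
    · exact hjj'.ne' (Prod.ext_iff.1 he).2
    · exact hne ⟨(Prod.ext_iff.1 he).1, (Prod.ext_iff.1 he).2.symm⟩
  · rcases hmem _ hm with he | he
    · exact (hij.trans hjj').ne' (Prod.ext_iff.1 he).1
    · exact hjj'.ne' (Prod.ext_iff.1 he).1
  · -- an edge `(i, j')` with `i < i'` could only arise from `k = j'`, and then `(i, j)` and `(i', j')` cross
    rintro rfl rfl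
    have hle : i' ≤ j := not_lt.1 fun hlt => h₃' _ hlt h₂
    exact hN _ _ _ _ h₁ h₁' ⟨ha, lt_of_le_of_ne hle fun he => hne ⟨he, rfl⟩, hjj'⟩
  · exact fun he => absurd he (hij.trans hjj').ne'

/-- Reducing at `j'` does not affect the longest pair at an earlier vertex `j`, unless the two pairs share the
edge `(j, j')`. -/
theorem IsLongestPair.sdiff_union_left {n : ℕ} {H : Finset (Fin n × Fin n)}
    (hN : IsNonCrossing H) {i j k i' j' k' : Fin n} (h : IsLongestPair H i j k)
    (h' : IsLongestPair H i' j' k') (hjj' : j < j') (hne : ¬ (i' = j ∧ k = j'))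
    {A : Finset (Fin n × Fin n)} (hA : A ⊆ {(i', j'), (j', k')}) :
    IsLongestPair ((H \ A) ∪ {(i', k')}) i j k := by
  obtain ⟨hij, hjk, h₁, h₂, h₃, h₄⟩ := h
  obtain ⟨hij', hjk', h₁', h₂', h₃', h₄'⟩ := h'
  have hmem : ∀ e, e ∈ A → e = (i', j') ∨ e = (j', k') := fun e he => by simpa using hA he
  simp only [IsLongestPair, Finset.mem_union, Finset.mem_sdiff, Finset.mem_singleton,
    Prod.mk.injEq, not_or, not_and]
  refine ⟨hij, hjk, Or.inl ⟨h₁, fun hm => ?_⟩, Or.inl ⟨h₂, fun hm => ?_⟩, fun a ha =>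
    ⟨fun hm => absurd hm (h₃ a ha), ?_⟩, fun b hb => ⟨fun hm => absurd hm (h₄ b hb), ?_⟩⟩
  · rcases hmem _ hm with he | he
    · exact hjj'.ne (Prod.ext_iff.1 he).2
    · exact (hjj'.trans hjk').ne (Prod.ext_iff.1 he).2
  · rcases hmem _ hm with he | he
    · exact hne ⟨(Prod.ext_iff.1 he).1.symm, (Prod.ext_iff.1 he).2⟩
    · exact hjj'.ne (Prod.ext_iff.1 he).1
  · exact fun _ he => absurd he (hjj'.trans hjk').ne
  · rintro rfl rfl
    have hle : j' ≤ k := not_lt.1 fun hlt => h₄ _ hlt h₁'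
    exact hN _ _ _ _ h₂ h₂' ⟨hjj', lt_of_le_of_ne hle fun he => hne ⟨rfl, he.symm⟩, hb⟩

theorem sdiff_union_comm {α : Type*} [DecidableEq α] {H A A' : Finset α} {e e' : α} (hA : A ⊆ H)
    (hA' : A' ⊆ H) (he : e ∉ H) (he' : e' ∉ H) :
    (((H \ A) ∪ {e}) \ A') ∪ {e'} = (((H \ A') ∪ {e'}) \ A) ∪ {e} := by
  have h₁ : e ∉ A' := fun h => he (hA' h)
  have h₂ : e' ∉ A := fun h => he' (hA h)
  ext x
  simp only [Finset.mem_union, Finset.mem_sdiff, Finset.mem_singleton]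
  by_cases hx : x = e
  · subst hx; tauto
  · by_cases hx' : x = e'
    · subst hx'; tauto
    · tauto

/-- Reductions at longest pairs without a common edge commute. -/
theorem reducedSum_eq_of_not_adjacent {n : ℕ} {V : Finset (Fin n)} {H : Finset (Fin n × Fin n)}
    (hH : IsNonCrossingForest V H)
    (ih : ∀ H', deficiency H' < deficiency H → IsNonCrossingForest V H' →
      ∀ i j k, IsLongestPair H' i j k → normalForm H' = reducedSum H' i j k)
    {i j k i' j' k' : Fin n} (h : IsLongestPair H i j k) (h' : IsLongestPair H i' j' k')
    (hjj' : j < j') (hne : ¬ (i' = j ∧ k = j')) :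
    reducedSum H i j k = reducedSum H i' j' k' := by
  have hik := hH.not_mem h
  have hik' := hH.not_mem h'
  have hs : ∀ {i j k}, IsLongestPair H i j k → {(j, k)} ⊆ H ∧ {(i, j)} ⊆ H ∧
      {(i, j), (j, k)} ⊆ H := fun h => by
    simp [Finset.insert_subset_iff, h.2.2.1, h.2.2.2.1]
  have hc₁ : ({(j, k)} : Finset _) ⊆ {(i, j), (j, k)} := by simp
  have hc₂ : ({(i, j)} : Finset _) ⊆ {(i, j), (j, k)} := by simp
  have hc₁' : ({(j', k')} : Finset _) ⊆ {(i', j'), (j', k')} := by simp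
  have hc₂' : ({(i', j')} : Finset _) ⊆ {(i', j'), (j', k')} := by simp
  have comm := fun {A A' : Finset (Fin n × Fin n)} (hA : A ⊆ H) (hA' : A' ⊆ H) =>
    sdiff_union_comm hA hA' hik hik'
  have r₁ := ih _ (deficiency_reduction₁_lt h) (hH.reduction₁ h) _ _ _
    (h.sdiff_union_right hH.1 h' hjj' hne hc₁)
  have r₂ := ih _ (deficiency_reduction₂_lt h) (hH.reduction₂ h) _ _ _
    (h.sdiff_union_right hH.1 h' hjj' hne hc₂)
  have r₃ := ih _ (deficiency_reduction₃_lt h) (hH.reduction₃ h) _ _ _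
    (h.sdiff_union_right hH.1 h' hjj' hne subset_rfl)
  have l₁ := ih _ (deficiency_reduction₁_lt h') (hH.reduction₁ h') _ _ _
    (h.sdiff_union_left hH.1 h' hjj' hne hc₁')
  have l₂ := ih _ (deficiency_reduction₂_lt h') (hH.reduction₂ h') _ _ _
    (h.sdiff_union_left hH.1 h' hjj' hne hc₂')
  have l₃ := ih _ (deficiency_reduction₃_lt h') (hH.reduction₃ h') _ _ _
    (h.sdiff_union_left hH.1 h' hjj' hne subset_rfl)
  obtain ⟨s₁, s₂, s₃⟩ := hs h
  obtain ⟨s₁', s₂', s₃'⟩ := hs h'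
  rw [reducedSum, reducedSum, r₁, r₂, r₃, l₁, l₂, l₃]
  simp only [reducedSum]
  rw [show reduction₁ (reduction₁ H i j k) i' j' k' = reduction₁ (reduction₁ H i' j' k') i j k from
      comm s₁ s₁',
    show reduction₂ (reduction₁ H i j k) i' j' k' = reduction₁ (reduction₂ H i' j' k') i j k from
      comm s₁ s₂',
    show reduction₃ (reduction₁ H i j k) i' j' k' = reduction₁ (reduction₃ H i' j' k') i j k from
      comm s₁ s₃',
    show reduction₁ (reduction₂ H i j k) i' j' k' = reduction₂ (reduction₁ H i' j' k') i j k from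
      comm s₂ s₁',
    show reduction₂ (reduction₂ H i j k) i' j' k' = reduction₂ (reduction₂ H i' j' k') i j k from
      comm s₂ s₂',
    show reduction₃ (reduction₂ H i j k) i' j' k' = reduction₂ (reduction₃ H i' j' k') i j k from
      comm s₂ s₃',
    show reduction₁ (reduction₃ H i j k) i' j' k' = reduction₃ (reduction₁ H i' j' k') i j k from
      comm s₃ s₁',
    show reduction₂ (reduction₃ H i j k) i' j' k' = reduction₃ (reduction₂ H i' j' k') i j k from
      comm s₃ s₂',
    show reduction₃ (reduction₃ H i j k) i' j' k' = reduction₃ (reduction₃ H i' j' k') i j k from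
      comm s₃ s₃']
  ring

/-- The critical case: the longest pairs at the inner vertices of a path `a → b → c → d`. Both ways of
reducing the path lead to the same eleven graphs. -/
theorem reducedSum_eq_of_adjacent {n : ℕ} {V : Finset (Fin n)} {H : Finset (Fin n × Fin n)}
    (hH : IsNonCrossingForest V H)
    (ih : ∀ H', deficiency H' < deficiency H → IsNonCrossingForest V H' →
      ∀ i j k, IsLongestPair H' i j k → normalForm H' = reducedSum H' i j k)
    {a b c d : Fin n} (h : IsLongestPair H a b c) (h' : IsLongestPair H b c d) :
    reducedSum H a b c = reducedSum H b c d := by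
  have hac := hH.not_mem h
  have hbd := hH.not_mem h'
  -- if the pair at `b` is reduced first, the next one is `(a, c)`, `(c, d)`
  obtain ⟨p₁, p₂, p₃, p₂₂⟩ : IsLongestPair (reduction₁ H a b c) a c d ∧
      IsLongestPair (reduction₂ H a b c) a c d ∧ IsLongestPair (reduction₃ H a b c) a c d ∧
      IsLongestPair (reduction₂ (reduction₂ H a b c) a c d) b c d := by
    simp only [IsLongestPair, mem_reduction₁, mem_reduction₂, mem_reduction₃, Prod.mk.injEq] at h h' ⊢
    refine ⟨?_, ?_, ?_, ?_⟩ <;> grind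
  -- if the pair at `c` is reduced first, the next one is `(a, b)`, `(b, d)`
  obtain ⟨q₁, q₂, q₃, q₁₁⟩ : IsLongestPair (reduction₁ H b c d) a b d ∧
      IsLongestPair (reduction₂ H b c d) a b d ∧ IsLongestPair (reduction₃ H b c d) a b d ∧
      IsLongestPair (reduction₁ (reduction₁ H b c d) a b d) a b c := by
    simp only [IsLongestPair, mem_reduction₁, mem_reduction₂, mem_reduction₃, Prod.mk.injEq] at h h' ⊢
    refine ⟨?_, ?_, ?_, ?_⟩ <;> grind
  have had : (a, d) ∉ H := fun hm =>
    (hH.reduction₁ h).not_mem p₁ (mem_reduction₁.2 (Or.inl ⟨hm, by simp [h.1.ne]⟩))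
  have g₁ := hH.reduction₁ h
  have g₂ := hH.reduction₂ h
  have g₃ := hH.reduction₃ h
  have g₁' := hH.reduction₁ h'
  have g₂' := hH.reduction₂ h'
  have g₃' := hH.reduction₃ h'
  have d₂ := deficiency_reduction₂_lt h
  have d₁' := deficiency_reduction₁_lt h'
  have e₁ := ih _ (deficiency_reduction₁_lt h) g₁ _ _ _ p₁
  have e₂ := ih _ d₂ g₂ _ _ _ p₂
  have e₃ := ih _ (deficiency_reduction₃_lt h) g₃ _ _ _ p₃
  have e₂₂ := ih _ ((deficiency_reduction₂_lt p₂).trans d₂) (g₂.reduction₂ p₂) _ _ _ p₂₂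
  have e₁' := ih _ d₁' g₁' _ _ _ q₁
  have e₂' := ih _ (deficiency_reduction₂_lt h') g₂' _ _ _ q₂
  have e₃' := ih _ (deficiency_reduction₃_lt h') g₃' _ _ _ q₃
  have e₁₁' := ih _ ((deficiency_reduction₁_lt q₁).trans d₁') (g₁'.reduction₁ q₁) _ _ _ q₁₁
  rw [reducedSum, reducedSum, e₁, e₂, e₃, e₁', e₂', e₃']
  simp only [reducedSum] at e₂₂ e₁₁' ⊢
  rw [e₂₂, e₁₁']
  have ⟨hab, hbc, mab, mbc, _, _⟩ := h
  have ⟨_, hcd, _, mcd, _, _⟩ := h'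
  have n₁ : (a, b) ≠ (b, c) := by simp [hab.ne]
  have n₂ : (a, b) ≠ (c, d) := by simp [(hab.trans hbc).ne]
  have n₃ : (b, c) ≠ (c, d) := by simp [hbc.ne]
  have n₄ : (a, c) ≠ (a, d) := by simp [hcd.ne]
  have n₅ : (a, c) ≠ (b, d) := by simp [hab.ne]
  have n₆ : (a, d) ≠ (b, d) := by simp [hab.ne]
  obtain ⟨t₁, t₂, t₃, t₄, t₅, t₆, t₇, t₈, t₉, t₁₀, t₁₁⟩ :
      reduction₁ (reduction₁ H a b c) a c d =
        reduction₁ (reduction₁ (reduction₁ H b c d) a b d) a b c ∧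
      reduction₂ (reduction₁ H a b c) a c d = reduction₁ (reduction₂ H b c d) a b d ∧
      reduction₃ (reduction₁ H a b c) a c d = reduction₁ (reduction₃ H b c d) a b d ∧
      reduction₁ (reduction₂ H a b c) a c d =
        reduction₂ (reduction₁ (reduction₁ H b c d) a b d) a b c ∧
      reduction₁ (reduction₂ (reduction₂ H a b c) a c d) b c d =
        reduction₂ (reduction₁ H b c d) a b d ∧
      reduction₂ (reduction₂ (reduction₂ H a b c) a c d) b c d =
        reduction₂ (reduction₂ H b c d) a b d ∧
      reduction₃ (reduction₂ (reduction₂ H a b c) a c d) b c d =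
        reduction₂ (reduction₃ H b c d) a b d ∧
      reduction₃ (reduction₂ H a b c) a c d = reduction₃ (reduction₁ H b c d) a b d ∧
      reduction₁ (reduction₃ H a b c) a c d =
        reduction₃ (reduction₁ (reduction₁ H b c d) a b d) a b c ∧
      reduction₂ (reduction₃ H a b c) a c d = reduction₃ (reduction₂ H b c d) a b d ∧
      reduction₃ (reduction₃ H a b c) a c d = reduction₃ (reduction₃ H b c d) a b d := by
    clear * - mab mbc mcd hac hbd had n₁ n₂ n₃ n₄ n₅ n₆
    simp only [Finset.ext_iff, mem_reduction₁, mem_reduction₂, mem_reduction₃]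
    generalize (a, b) = x at *
    generalize (b, c) = y at *
    generalize (c, d) = z at *
    generalize (a, c) = u at *
    generalize (b, d) = v at *
    generalize (a, d) = w at *
    refine ⟨?_, ?_, ?_, ?_, ?_, ?_, ?_, ?_, ?_, ?_, ?_⟩ <;> grind
  rw [t₁, t₂, t₃, t₄, t₅, t₆, t₇, t₈, t₉, t₁₀, t₁₁]
  ring

theorem normalForm_eq {n : ℕ} {V : Finset (Fin n)} (H : Finset (Fin n × Fin n))
    (hH : IsNonCrossingForest V H) (i j k : Fin n) (h : IsLongestPair H i j k) :
    normalForm H = reducedSum H i j k := by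
  induction hN : deficiency H using Nat.strong_induction_on generalizing H i j k with
  | _ N ih =>
    subst hN
    have ih' : ∀ H', deficiency H' < deficiency H → IsNonCrossingForest V H' →
        ∀ i j k, IsLongestPair H' i j k → normalForm H' = reducedSum H' i j k :=
      fun H' hlt hH' i j k h => ih _ hlt H' hH' i j k h rfl
    have key : ∀ {i j k i' j' k'}, IsLongestPair H i j k → IsLongestPair H i' j' k' → j < j' →
        reducedSum H i j k = reducedSum H i' j' k' := by
      intro i j k i' j' k' h h' hlt
      by_cases hadj : i' = j ∧ k = j'
      · obtain ⟨rfl, rfl⟩ := hadj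
        exact reducedSum_eq_of_adjacent hH ih' h h'
      · exact reducedSum_eq_of_not_adjacent hH ih' h h' hlt hadj
    have hex : ∃ p : Fin n × Fin n × Fin n, IsLongestPair H p.1 p.2.1 p.2.2 := ⟨(i, j, k), h⟩
    rw [normalForm, dif_pos hex]
    change reducedSum H _ _ _ = _
    have hc := hex.choose_spec
    rcases lt_trichotomy hex.choose.2.1 j with hlt | heq | hlt
    · exact key hc h hlt
    · rw [heq] at hc ⊢
      obtain ⟨h₁, h₂⟩ := hc.unique h
      rw [h₁, h₂]
    · exact (key h hc hlt).symm

theorem normalForm_of_isAlternating {n : ℕ} {H : Finset (Fin n × Fin n)} (hH : IsAlternating H) :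
    normalForm H = graphMonomial H := by
  rw [normalForm, dif_neg]
  rintro ⟨⟨i, j, k⟩, h⟩
  exact hH i j k h.1 h.2.1 h.2.2.1 h.2.2.2.1

/-! ### Reduced forms of polynomials -/

/-- The exponent vector of the monomial of `H`. -/
noncomputable def exponent {n : ℕ} (H : Finset (Fin n × Fin n)) : (Fin n × Fin n) →₀ ℕ :=
  ∑ e ∈ H, Finsupp.single e 1

theorem graphMonomial_eq {n : ℕ} (H : Finset (Fin n × Fin n)) :
    graphMonomial H = MvPolynomial.monomial (exponent H) 1 := by
  rw [graphMonomial, exponent, MvPolynomial.monomial_sum_one]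
  rfl

theorem exponent_apply {n : ℕ} (H : Finset (Fin n × Fin n)) (e : Fin n × Fin n) :
    exponent H e = if e ∈ H then 1 else 0 := by
  simp [exponent, Finsupp.finsetSum_apply, Finsupp.single_apply]

theorem support_exponent {n : ℕ} (H : Finset (Fin n × Fin n)) : (exponent H).support = H := by
  ext e
  simp [exponent_apply]

theorem exponent_insert {n : ℕ} {H : Finset (Fin n × Fin n)} {e : Fin n × Fin n} (he : e ∉ H) :
    exponent (insert e H) = Finsupp.single e 1 + exponent H :=
  Finset.sum_insert he

/-- As `(i, k)` is not an edge of `H`, the three monomials of the reduction are square-free, and thus those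
of the three reduced graphs. -/
theorem reduceMonomial_exponent {n : ℕ} {H : Finset (Fin n × Fin n)} {i j k : Fin n}
    (h : IsLongestPair H i j k) (hik : (i, k) ∉ H) (c : Polynomial ℤ) :
    reduceMonomial i j k (exponent H) c =
      MvPolynomial.monomial (exponent (reduction₁ H i j k)) c +
      MvPolynomial.monomial (exponent (reduction₂ H i j k)) c +
      MvPolynomial.monomial (exponent (reduction₃ H i j k)) (Polynomial.X * c) := by
  obtain ⟨hij, hjk, h₁, h₂, -⟩ := h
  have n₁ : (i, j) ≠ (j, k) := by simp [hij.ne]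
  have n₂ : (i, k) ≠ (i, j) := by simp [hjk.ne']
  have n₃ : (i, k) ≠ (j, k) := by simp [hij.ne]
  obtain ⟨K, hK, hK₁, hK₂⟩ : ∃ K, H = insert (i, j) (insert (j, k) K) ∧ (i, j) ∉ K ∧ (j, k) ∉ K :=
    ⟨H \ {(i, j), (j, k)}, by
      ext e
      simp only [Finset.mem_insert, Finset.mem_sdiff, Finset.mem_singleton]
      grind, by simp, by simp⟩
  have hK₃ : (i, k) ∉ K := fun h => hik (by simp [hK, h])
  have r₁ : reduction₁ H i j k = insert (i, j) (insert (i, k) K) := by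
    ext e
    rw [mem_reduction₁, hK]
    simp only [Finset.mem_insert]
    grind
  have r₂ : reduction₂ H i j k = insert (j, k) (insert (i, k) K) := by
    ext e
    rw [mem_reduction₂, hK]
    simp only [Finset.mem_insert]
    grind
  have r₃ : reduction₃ H i j k = insert (i, k) K := by
    ext e
    rw [mem_reduction₃, hK]
    simp only [Finset.mem_insert]
    grind
  rw [r₁, r₂, r₃, hK, exponent_insert (by simp [n₁, hK₁]), exponent_insert hK₂,
    exponent_insert (H := insert (i, k) K) (by simp [n₂.symm, hK₁]),
    exponent_insert (H := insert (i, k) K) (by simp [n₃.symm, hK₂]),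
    exponent_insert hK₃, ← add_assoc, reduceMonomial, add_tsub_cancel_left, replacement]
  simp only [MvPolynomial.X, MvPolynomial.C_apply, MvPolynomial.monomial_mul, mul_add, mul_one]
  rw [zero_add, mul_comm c, ← add_assoc (exponent K), ← add_assoc (exponent K),
    add_comm (exponent K) (Finsupp.single (i, k) 1), add_comm _ (Finsupp.single (i, j) 1),
    add_comm (exponent K) (Finsupp.single (j, k) 1), add_assoc (Finsupp.single (j, k) 1),
    add_comm (exponent K) (Finsupp.single (i, k) 1)]

/-- The linear extension of the normal form from monomials to polynomials. -/
noncomputable def normalFormLinear (n : ℕ) : Poly n →ₗ[Polynomial ℤ] Poly n :=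
  (MvPolynomial.basisMonomials (Fin n × Fin n) (Polynomial ℤ)).constr (Polynomial ℤ)
    fun m => normalForm m.support

theorem normalFormLinear_monomial {n : ℕ} (m : (Fin n × Fin n) →₀ ℕ) (c : Polynomial ℤ) :
    normalFormLinear n (MvPolynomial.monomial m c) = MvPolynomial.C c * normalForm m.support := by
  have h : MvPolynomial.monomial m c =
      c • MvPolynomial.basisMonomials (Fin n × Fin n) (Polynomial ℤ) m := by
    rw [MvPolynomial.coe_basisMonomials, MvPolynomial.smul_monomial, smul_eq_mul, mul_one]
  rw [h, map_smul, normalFormLinear, Module.Basis.constr_basis, MvPolynomial.smul_eq_C_mul]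

/-- All monomials of `p` are monomials of non-crossing graphs contained in a spanning tree of `V`. -/
def HasForestMonomials {n : ℕ} (V : Finset (Fin n)) (p : Poly n) : Prop :=
  ∀ m ∈ p.support, ∃ H, IsNonCrossingForest V H ∧ m = exponent H

theorem HasForestMonomials.sum {n : ℕ} {V : Finset (Fin n)} {ι : Type*} {s : Finset ι}
    {p : ι → Poly n} (h : ∀ x ∈ s, HasForestMonomials V (p x)) :
    HasForestMonomials V (∑ x ∈ s, p x) := by
  intro m hm
  rw [MvPolynomial.mem_support_iff, MvPolynomial.coeff_sum] at hm
  obtain ⟨x, hx, hne⟩ := Finset.exists_ne_zero_of_sum_ne_zero hm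
  exact h x hx m (MvPolynomial.mem_support_iff.2 hne)

theorem HasForestMonomials.add {n : ℕ} {V : Finset (Fin n)} {p q : Poly n}
    (hp : HasForestMonomials V p) (hq : HasForestMonomials V q) : HasForestMonomials V (p + q) :=
  fun m hm => (Finset.mem_union.1 (MvPolynomial.support_add hm)).elim (hp m) (hq m)

theorem hasForestMonomials_monomial {n : ℕ} {V : Finset (Fin n)} {H : Finset (Fin n × Fin n)}
    (hH : IsNonCrossingForest V H) (c : Polynomial ℤ) :
    HasForestMonomials V (MvPolynomial.monomial (exponent H) c) := fun _ hm =>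
  ⟨H, hH, Finset.mem_singleton.1 (MvPolynomial.support_monomial_subset hm)⟩

theorem LongestReductionStep.hasForestMonomials {n : ℕ} {V : Finset (Fin n)} {p p' : Poly n}
    (h : LongestReductionStep p p') (hp : HasForestMonomials V p) : HasForestMonomials V p' := by
  obtain ⟨i, j, k, S, -, -, hS, rfl⟩ := h
  refine HasForestMonomials.sum fun m hm => ?_
  obtain ⟨H, hH, rfl⟩ := hp m hm
  split_ifs with hmS
  · have hlp := hS _ hmS
    rw [support_exponent] at hlp
    rw [reduceMonomial_exponent hlp (hH.not_mem hlp)]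
    exact ((hasForestMonomials_monomial (hH.reduction₁ hlp) _).add
      (hasForestMonomials_monomial (hH.reduction₂ hlp) _)).add
      (hasForestMonomials_monomial (hH.reduction₃ hlp) _)
  · exact hasForestMonomials_monomial hH _

theorem LongestReductionStep.normalFormLinear_eq {n : ℕ} {V : Finset (Fin n)} {p p' : Poly n}
    (h : LongestReductionStep p p') (hp : HasForestMonomials V p) :
    normalFormLinear n p' = normalFormLinear n p := by
  obtain ⟨i, j, k, S, -, -, hS, rfl⟩ := h
  conv_rhs => rw [← MvPolynomial.support_sum_monomial_coeff p]
  rw [reduceOn, map_sum, map_sum]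
  refine Finset.sum_congr rfl fun m hm => ?_
  obtain ⟨H, hH, rfl⟩ := hp m hm
  split_ifs with hmS
  · have hlp := hS _ hmS
    rw [support_exponent] at hlp
    rw [reduceMonomial_exponent hlp (hH.not_mem hlp)]
    simp only [map_add, normalFormLinear_monomial, support_exponent, map_mul]
    rw [normalForm_eq H hH i j k hlp, reducedSum]
    ring
  · rfl

theorem IsReduced.normalFormLinear_eq {n : ℕ} {V : Finset (Fin n)} {p : Poly n} (h : IsReduced p)
    (hp : HasForestMonomials V p) : normalFormLinear n p = p := by
  conv_lhs => rw [← MvPolynomial.support_sum_monomial_coeff p]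
  conv_rhs => rw [← MvPolynomial.support_sum_monomial_coeff p]
  rw [map_sum]
  refine Finset.sum_congr rfl fun m hm => ?_
  obtain ⟨H, hH, rfl⟩ := hp m hm
  have hA := h _ hm
  rw [support_exponent] at hA
  rw [normalFormLinear_monomial, support_exponent, normalForm_of_isAlternating hA,
    graphMonomial_eq, MvPolynomial.C_mul_monomial, mul_one]

theorem IsLongestReducedForm.eq_normalFormLinear {n : ℕ} {V : Finset (Fin n)} {p q : Poly n}
    (h : IsLongestReducedForm p q) (hp : HasForestMonomials V p) : q = normalFormLinear n p := by
  obtain ⟨hpq, hq⟩ := h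
  have key : HasForestMonomials V q ∧ normalFormLinear n q = normalFormLinear n p := by
    clear hq
    induction hpq with
    | refl => exact ⟨hp, rfl⟩
    | tail _ hs ih => exact ⟨hs.hasForestMonomials ih.1, (hs.normalFormLinear_eq ih.1).trans ih.2⟩
  rw [← key.2, hq.normalFormLinear_eq key.1]

theorem hasForestMonomials_graphMonomial {n : ℕ} {I J : Finset (Fin n)} (hIJ : IsValidPair I J) :
    HasForestMonomials (vertexSet I J) (graphMonomial (graphIJ I J)) := by
  rw [graphMonomial_eq]
  exact hasForestMonomials_monomial
    ⟨graphIJ_isNonCrossing I J, _, subset_rfl, graphIJ_isSpanningTree hIJ⟩ 1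

end IJTamari

theorem proposition4p4 {n : ℕ} (I J : Finset (Fin n)) (hIJ : IJTamari.IsValidPair I J) :
    (∀ p q : IJTamari.Poly n,
      IJTamari.IsLongestReducedForm (IJTamari.graphMonomial (IJTamari.graphIJ I J)) p →
      IJTamari.IsLongestReducedForm (IJTamari.graphMonomial (IJTamari.graphIJ I J)) q →
      p = q) ∧
    (∀ R : IJTamari.LongestReductionTree (IJTamari.graphIJ I J),
      R.fullDimensionalLeaves = IJTamari.maximalAltNonCrossing I J) ∧
    (∀ H ∈ IJTamari.maximalAltNonCrossing I J,
      IJTamari.IsTreeOn (IJTamari.vertexSet I J) H) := by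
  have hM := IJTamari.hasForestMonomials_graphMonomial hIJ
  exact ⟨fun p q hp hq => (hp.eq_normalFormLinear hM).trans (hq.eq_normalFormLinear hM).symm,
    fun R => R.fullDimensionalLeaves_eq hIJ,
    fun H hH => IJTamari.isTreeOn_of_mem_maximalAltNonCrossing hIJ hH⟩
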